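/- **Syntax.** Types are $N$ and $\sigma\to\tau$. Sequents are $\vec\sigma\Rightarrow\tau$ with $\vec\sigma$ a list of types; write $\vec\sigma\to\tau$ for $\sigma_1\to\cdots\to\sigma_n\to\tau$. The rule instances (steps), written "premisses / conclusion", are $\mathsf{id}$: $/\ \sigma\Rightarrow\sigma$; $\mathsf{ex}$: $\vec\rho,\sigma,\rho,\vec\sigma\Rightarrow\tau\ /\ \vec\rho,\rho,\sigma,\vec\sigma\Rightarrow\tau$; $\mathsf{wk}$: $\vec\sigma\Rightarrow\tau\ /\ \vec\sigma,\sigma\Rightarrow\tau$; $\mathsf{cntr}$: $\vec\sigma,\sigma,\sigma\Rightarrow\tau\ /\ \vec\sigma,\sigma\Rightarrow\tau$; $\mathsf{cut}$: $\vec\sigma\Rightarrow\sigma$ and $\vec\sigma,\sigma\Rightarrow\tau\ /\ \vec\sigma\Rightarrow\tau$; $\mathsf{L}$: $\vec\sigma\Rightarrow\rho$ and $\vec\sigma,\sigma\Rightarrow\tau\ /\ \vec\sigma,\rho\to\sigma\Rightarrow\tau$; $\mathsf{R}$: $\vec\sigma,\sigma\Rightarrow\tau\ /\ \vec\sigma\Rightarrow\sigma\to\tau$;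 $0$: $/\ \Rightarrow N$; $\mathsf{s}$: $/\ N\Rightarrow N$; $\mathsf{cond}$: $\vec\sigma\Rightarrow\tau$ and $\vec\sigma,N\Rightarrow\tau\ /\ \vec\sigma,N\Rightarrow\tau$. Each step is a constant whose type takes (the types of) its premisses to (the type of) its conclusion, a sequent $\vec\sigma\Rightarrow\tau$ having type $\vec\sigma\to\tau$. A *coderivation* is a possibly infinite tree of steps in which premisses match the conclusions of the children. It is *regular* if it has finitely many distinct subtrees. It is *progressing* if along every infinite branch, from some node on, some occurrence of $N$ on the left-hand side can be traced upwards for ever through immediate ancestors and is infinitely often the principal $N$ of a $\mathsf{cond}$ step. (Immediate ancestry relates an occurrence on the left of a premiss to one on the left of the conclusion: it links corresponding occurrences of the side lists, follows the swap in $\mathsf{ex}$, links both copies of the contracted type in $\mathsf{cntr}$ to it, and links the displayed $N$ of the right premiss of $\mathsf{cond}$ to the principal $N$. There are no other links.) *Coterms* are possibly infinite trees of binary applications with typed variables and constants at the leaves. A coderivation with root step $\mathsf r$ and immediate sub-coderivations $d_1,\dots,d_k$ is, coinductively, the coterm $\mathsf r\,d_1\cdots d_k$. Fix sets of variables $V_\sigma$,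 one for each type $\sigma$ (possibly empty). A *farc* of type $\sigma$ is a (well-typed) finite application of regular coderivations, constants and variables from $V$. *Reduction* is the least relation closed under contexts with $\mathsf{id}\,x\rightsquigarrow x$, $\mathsf{ex}\,t\,\vec x\,x\,y\,\vec y\rightsquigarrow t\,\vec x\,y\,x\,\vec y$, $\mathsf{wk}\,t\,\vec x\,x\rightsquigarrow t\,\vec x$, $\mathsf{cntr}\,t\,\vec x\,x\rightsquigarrow t\,\vec x\,x\,x$, $\mathsf{cut}\,s\,t\,\vec x\rightsquigarrow t\,\vec x\,(s\,\vec x)$, $\mathsf{L}\,s\,t\,\vec x\,y\rightsquigarrow t\,\vec x\,(y\,(s\,\vec x))$, $\mathsf{R}\,t\,\vec x\,x\rightsquigarrow t\,\vec x\,x$, $\mathsf{cond}\,s\,t\,\vec x\,0\rightsquigarrow s\,\vec x$, $\mathsf{cond}\,s\,t\,\vec x\,(\mathsf s\,y)\rightsquigarrow t\,\vec x\,y$. *Conversion* $\approx$ is the equivalence relation on the farcs of each type generated by $\rightsquigarrow$. **The theory.** $\mathit{CT}$ is a many-sorted first-order classical theory, with the types as sorts, application, and an equality symbol at each type. Its constants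 are all steps and all regular progressing coderivations; its terms are identified with the coterms that they denote. The axioms are reflexivity, the Leibniz schema $s=t\wedge\varphi(s)\supset\varphi(t)$, the equations obtained from the reductions above by replacing $\rightsquigarrow$ with $=$, and $\neg\,\mathsf s\,x=0$ and $\mathsf s\,x=\mathsf s\,y\supset x=y$. Its rules are induction (from $\vdash\varphi(0)$ and $\vdash\varphi(x)\supset\varphi(\mathsf s\,x)$ infer $\vdash\varphi(t)$, for $\varphi$ quantifier-free) and extensionality $\mathrm{ER}$ (from $\vdash s\,x=t\,x$ with $x$ fresh infer $\vdash s=t$). $\mathit{CT}\setminus\mathrm{ER}$ is $\mathit{CT}$ without the rule $\mathrm{ER}$. **The structures.** Let $\mathrm{HR}_N$ be the set of farcs $t$ of type $N$ with $t\approx\mathsf s^n0$ for some $n\in\mathbb N$, and let $\mathrm{HR}_{\sigma\to\tau}$ be the set of farcs $t$ of type $\sigma\to\tau$ with $t\,s\in\mathrm{HR}_\tau$ for all $s\in\mathrm{HR}_\sigma$. The structure $\mathrm{HR}$ interprets each type $\sigma$ by $\mathrm{HR}_\sigma$, constants and application by themselves, and equality by $\approx$. The structure $\mathrm{HE}$ is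 the same except that equality is interpreted by $\simeq$, where $\simeq_N$ is $\approx$ and $t\simeq_{\sigma\to\tau}t'$ iff $t\,s\simeq_\tau t'\,s$ for all $s\in\mathrm{HR}_\sigma$. A structure is a *model* of $\mathit{CT}$ (of $\mathit{CT}\setminus\mathrm{ER}$) if its domains are non-empty, closed under application and contain the interpretations of all constants, all theorems of the theory are valid in it (true under all assignments), and its set of valid formulas is closed under the rules of the theory. **Corollary.** $\mathrm{HR}$ is a model of $\mathit{CT}\setminus\mathrm{ER}$, and $\mathrm{HE}$ is a model of $\mathit{CT}$. -/

import Mathlib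

namespace CircularT

/-! ## Simple types, sequents and the rules of the calculus -/

/-- Simple types over the base type `N`. -/
inductive Ty : Type
  | N : Ty
  | arr : Ty → Ty → Ty

/-- `arrows [σ₁, …, σₙ] τ` is the type `σ₁ → ⋯ → σₙ → τ`. -/
def arrows : List Ty → Ty → Ty
  | [], τ => τ
  | σ :: σs, τ => Ty.arr σ (arrows σs τ)

/-- A sequent `σ₁, …, σₙ ⇒ τ`. -/
structure Sequent : Type where
  ctx : List Ty
  goal : Ty

/-- The type `σ₁ → ⋯ → σₙ → τ` of a sequent `σ₁, …, σₙ ⇒ τ`. -/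
def Sequent.toTy (S : Sequent) : Ty := arrows S.ctx S.goal

/-- The rule instances ("steps") of the sequent calculus with `0`, successor and `cond`,
but without recursors. -/
inductive Rule : Type
  | id (σ : Ty)
  | ex (ρs : List Ty) (ρ σ : Ty) (σs : List Ty) (τ : Ty)
  | wk (σs : List Ty) (σ τ : Ty)
  | cntr (σs : List Ty) (σ τ : Ty)
  | cut (σs : List Ty) (σ τ : Ty)
  | L (σs : List Ty) (ρ σ τ : Ty)
  | R (σs : List Ty) (σ τ : Ty)
  | zero
  | succ
  | cond (σs : List Ty) (τ : Ty)

/-- The list of premisses of a step. -/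
def Rule.premises : Rule → List Sequent
  | .id _ => []
  | .ex ρs ρ σ σs τ => [⟨ρs ++ σ :: ρ :: σs, τ⟩]
  | .wk σs _ τ => [⟨σs, τ⟩]
  | .cntr σs σ τ => [⟨σs ++ [σ, σ], τ⟩]
  | .cut σs σ τ => [⟨σs, σ⟩, ⟨σs ++ [σ], τ⟩]
  | .L σs ρ σ τ => [⟨σs, ρ⟩, ⟨σs ++ [σ], τ⟩]
  | .R σs σ τ => [⟨σs ++ [σ], τ⟩]
  | .zero => []
  | .succ => []
  | .cond σs τ => [⟨σs, τ⟩, ⟨σs ++ [Ty.N], τ⟩]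

/-- The conclusion of a step. -/
def Rule.conclusion : Rule → Sequent
  | .id σ => ⟨[σ], σ⟩
  | .ex ρs ρ σ σs τ => ⟨ρs ++ ρ :: σ :: σs, τ⟩
  | .wk σs σ τ => ⟨σs ++ [σ], τ⟩
  | .cntr σs σ τ => ⟨σs ++ [σ], τ⟩
  | .cut σs _ τ => ⟨σs, τ⟩
  | .L σs ρ σ τ => ⟨σs ++ [Ty.arr ρ σ], τ⟩
  | .R σs σ τ => ⟨σs, Ty.arr σ τ⟩
  | .zero => ⟨[], Ty.N⟩
  | .succ => ⟨[Ty.N], Ty.N⟩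
  | .cond σs τ => ⟨σs ++ [Ty.N], τ⟩

/-- Each step is a constant (combinator); this is its type
`(premiss₁) → ⋯ → (premissₖ) → (conclusion)`. -/
def Rule.toTy (r : Rule) : Ty := arrows (r.premises.map Sequent.toTy) r.conclusion.toTy

/-- Immediate ancestry for one step: `r.Ancestor i p q` says that the type occurrence at position
`p` (counted from `0`) of the left-hand side of premiss number `i` is an immediate ancestor of the
occurrence at position `q` of the left-hand side of the conclusion. -/
def Rule.Ancestor : Rule → ℕ → ℕ → ℕ → Prop
  | .id _, _, _, _ => False
  | .ex ρs _ _ σs _, _, p, q =>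
      (p = q ∧ p < ρs.length) ∨
      (p = ρs.length ∧ q = ρs.length + 1) ∨
      (p = ρs.length + 1 ∧ q = ρs.length) ∨
      (p = q ∧ ρs.length + 2 ≤ p ∧ p < ρs.length + 2 + σs.length)
  | .wk σs _ _, _, p, q => p = q ∧ p < σs.length
  | .cntr σs _ _, _, p, q =>
      (p = q ∧ p < σs.length) ∨
      (q = σs.length ∧ (p = σs.length ∨ p = σs.length + 1))
  | .cut σs _ _, _, p, q => p = q ∧ p < σs.length
  | .L σs _ _ _, _, p, q => p = q ∧ p < σs.length
  | .R σs _ _, _, p, q => p = q ∧ p < σs.length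
  | .zero, _, _, _ => False
  | .succ, _, _, _ => False
  | .cond σs _, i, p, q =>
      (p = q ∧ p < σs.length) ∨ (i = 1 ∧ p = σs.length ∧ q = σs.length)

/-- The occurrence at position `q` of the left-hand side of the conclusion is the principal `N`
of a `cond` step. -/
def Rule.CondPrincipal (r : Rule) (q : ℕ) : Prop :=
  ∃ σs τ, r = Rule.cond σs τ ∧ q = σs.length

/-! ## Coderivations -/

/-- The shape of trees whose nodes are labelled by steps, with one child for each premiss. -/
def ruleFunctor : PFunctor.{0, 0} := ⟨Rule, fun r => Fin r.premises.length⟩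

/-- Possibly infinite trees labelled by steps. -/
abbrev RuleTree : Type := PFunctor.M ruleFunctor

namespace RuleTree

/-- The step at the root. -/
def rule (d : RuleTree) : Rule := PFunctor.M.head d

/-- The immediate subtrees. -/
def child (d : RuleTree) (i : Fin d.rule.premises.length) : RuleTree := PFunctor.M.children d i

/-- The sequent at the root. -/
def sequent (d : RuleTree) : Sequent := d.rule.conclusion

/-- `d.IsChild i e`: `e` is the immediate subtree of `d` number `i`. -/
def IsChild (d : RuleTree) (i : ℕ) (e : RuleTree) : Prop :=
  ∃ h : i < d.rule.premises.length, d.child ⟨i, h⟩ = e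

/-- `d.IsSub e`: `e` is a subtree of `d`. -/
def IsSub : RuleTree → RuleTree → Prop :=
  Relation.ReflTransGen fun d e => ∃ i, d.IsChild i e

/-- A coderivation is a locally correct tree: premisses match the conclusions of the children. -/
def IsCoderivation (d : RuleTree) : Prop :=
  ∀ e, d.IsSub e → ∀ i : Fin e.rule.premises.length,
    (e.child i).sequent = e.rule.premises.get i

/-- Regular: only finitely many distinct subtrees. -/
def IsRegular (d : RuleTree) : Prop := {e | d.IsSub e}.Finite

/-- Progressing: every infinite branch `b` (where `b (n + 1)` is child number `c n` of `b n`)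
has, from some node `b k` on, an `N`-thread `p` (where `p n` is a position in the left-hand side
of the sequent at `b (k + n)`) that is infinitely often principal for a `cond` step. -/
def IsProgressing (d : RuleTree) : Prop :=
  ∀ (b : ℕ → RuleTree) (c : ℕ → ℕ), b 0 = d → (∀ n, (b n).IsChild (c n) (b (n + 1))) →
    ∃ (k : ℕ) (p : ℕ → ℕ),
      (∀ n, (b (k + n)).sequent.ctx[p n]? = some Ty.N) ∧
      (∀ n, (b (k + n)).rule.Ancestor (c (k + n)) (p (n + 1)) (p n)) ∧
      (∀ m, ∃ n, m ≤ n ∧ (b (k + n)).rule.CondPrincipal (p n))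

end RuleTree

/-! ## Coterms, with typed variables from `V` -/

/-- Labels of the nodes of a coterm: binary application, variables, constants. -/
inductive CoLabel (V : Ty → Type) : Type
  | app
  | var (σ : Ty) (v : V σ)
  | const (r : Rule)

/-- Application nodes have two children, all other nodes are leaves. -/
def CoLabel.Arity {V : Ty → Type} : CoLabel V → Type
  | .app => Bool
  | .var _ _ => Empty
  | .const _ => Empty

/-- The shape of coterms. -/
def cotermFunctor (V : Ty → Type) : PFunctor.{0, 0} := ⟨CoLabel V, CoLabel.Arity⟩

/-- (Raw) coterms: possibly infinite trees of binary applications, with variables and constants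
at the leaves. -/
abbrev Coterm (V : Ty → Type) : Type := PFunctor.M (cotermFunctor V)

namespace Coterm

variable {V : Ty → Type}

/-- Application `t s`. -/
def app (t s : Coterm V) : Coterm V :=
  PFunctor.M.mk (F := cotermFunctor V)
    ⟨CoLabel.app, fun b : Bool => match b with
      | false => t
      | true => s⟩

/-- A variable. -/
def var {σ : Ty} (v : V σ) : Coterm V :=
  PFunctor.M.mk (F := cotermFunctor V) ⟨CoLabel.var σ v, fun e : Empty => e.elim⟩

/-- A constant. -/
def const (r : Rule) : Coterm V :=
  PFunctor.M.mk (F := cotermFunctor V) ⟨CoLabel.const r, fun e : Empty => e.elim⟩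

/-- Iterated application `t s₁ ⋯ sₙ`. -/
def apps (t : Coterm V) : List (Coterm V) → Coterm V
  | [] => t
  | s :: ss => apps (app t s) ss

end Coterm

/-- A coderivation `d` with root step `r` together with a number `k` of premisses; it stands for
the coterm `r d₁ ⋯ dₖ`, where `dᵢ` are the immediate sub-coderivations of `d`. -/
structure Spine : Type where
  tree : RuleTree
  count : ℕ
  le : count ≤ tree.rule.premises.length

/-- The spine in which the root step is applied to all its premisses. -/
def Spine.full (d : RuleTree) : Spine := ⟨d, d.rule.premises.length, le_rfl⟩

/-- One layer of the coterm of a spine: `r` if no premiss is present, and otherwise the application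
of `r d₁ ⋯ dₖ` to `dₖ₊₁`. -/
def Spine.step (V : Ty → Type) : Spine → cotermFunctor V Spine
  | ⟨d, 0, _⟩ => ⟨CoLabel.const d.rule, fun e : Empty => e.elim⟩
  | ⟨d, k + 1, h⟩ => ⟨CoLabel.app, fun b : Bool => match b with
      | false => ⟨d, k, Nat.le_of_succ_le h⟩
      | true => Spine.full (d.child ⟨k, h⟩)⟩

/-- The coterm of a spine. -/
def Spine.toCoterm (V : Ty → Type) (x : Spine) : Coterm V := PFunctor.M.corec (Spine.step V) x

/-- Coderivations construed as coterms, coinductively: a coderivation with root step `r` and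
immediate sub-coderivations `d₁, …, dₖ` is the coterm `r d₁ ⋯ dₖ`. -/
def RuleTree.toCoterm (V : Ty → Type) (d : RuleTree) : Coterm V := (Spine.full d).toCoterm V

theorem Spine.toCoterm_zero (V : Ty → Type) (d : RuleTree) (h : 0 ≤ d.rule.premises.length) :
    Spine.toCoterm V ⟨d, 0, h⟩ = Coterm.const d.rule := by
  unfold Spine.toCoterm Coterm.const
  rw [PFunctor.M.corec_def]
  refine congrArg _ (Sigma.ext rfl (heq_of_eq ?_))
  funext e
  exact e.elim

theorem Spine.toCoterm_succ (V : Ty → Type) (d : RuleTree) (k : ℕ)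
    (h : k + 1 ≤ d.rule.premises.length) :
    Spine.toCoterm V ⟨d, k + 1, h⟩ =
      Coterm.app (Spine.toCoterm V ⟨d, k, Nat.le_of_succ_le h⟩)
        ((d.child ⟨k, h⟩).toCoterm V) := by
  unfold RuleTree.toCoterm
  conv_lhs => unfold Spine.toCoterm
  unfold Coterm.app
  rw [PFunctor.M.corec_def]
  refine congrArg _ (Sigma.ext rfl (heq_of_eq ?_))
  funext b
  cases b <;> rfl

/-! ## Finite applications of regular coderivations (farcs), reduction and conversion -/

/-- `IsFarc σ t`: the coterm `t` of type `σ` is a finite application of regular coderivations,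
variables and constants. -/
inductive IsFarc {V : Ty → Type} : Ty → Coterm V → Prop
  | var {σ : Ty} (v : V σ) : IsFarc σ (Coterm.var v)
  | const (r : Rule) : IsFarc r.toTy (Coterm.const r)
  | coder (d : RuleTree) (hd : d.IsCoderivation) (hr : d.IsRegular) :
      IsFarc d.sequent.toTy (d.toCoterm V)
  | app {σ τ : Ty} {t s : Coterm V} (ht : IsFarc (Ty.arr σ τ) t) (hs : IsFarc σ s) :
      IsFarc τ (Coterm.app t s)

/-- One-step reduction of coterms: the reduction rules, closed under contexts. -/
inductive Red {V : Ty → Type} : Coterm V → Coterm V → Prop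
  | id (σ : Ty) (x : Coterm V) :
      Red (Coterm.app (Coterm.const (Rule.id σ)) x) x
  | ex (ρs : List Ty) (ρ σ : Ty) (σs : List Ty) (τ : Ty) (t x y : Coterm V)
      (xs ys : List (Coterm V)) (hx : xs.length = ρs.length) (hy : ys.length = σs.length) :
      Red (((Coterm.const (Rule.ex ρs ρ σ σs τ)).app t).apps (xs ++ x :: y :: ys))
        (t.apps (xs ++ y :: x :: ys))
  | wk (σs : List Ty) (σ τ : Ty) (t x : Coterm V)
      (xs : List (Coterm V)) (hx : xs.length = σs.length) :
      Red (((Coterm.const (Rule.wk σs σ τ)).app t).apps (xs ++ [x])) (t.apps xs)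
  | cntr (σs : List Ty) (σ τ : Ty) (t x : Coterm V)
      (xs : List (Coterm V)) (hx : xs.length = σs.length) :
      Red (((Coterm.const (Rule.cntr σs σ τ)).app t).apps (xs ++ [x])) (t.apps (xs ++ [x, x]))
  | cut (σs : List Ty) (σ τ : Ty) (s t : Coterm V)
      (xs : List (Coterm V)) (hx : xs.length = σs.length) :
      Red ((((Coterm.const (Rule.cut σs σ τ)).app s).app t).apps xs)
        (t.apps (xs ++ [s.apps xs]))
  | L (σs : List Ty) (ρ σ τ : Ty) (s t y : Coterm V)
      (xs : List (Coterm V)) (hx : xs.length = σs.length) :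
      Red ((((Coterm.const (Rule.L σs ρ σ τ)).app s).app t).apps (xs ++ [y]))
        (t.apps (xs ++ [y.app (s.apps xs)]))
  | R (σs : List Ty) (σ τ : Ty) (t x : Coterm V)
      (xs : List (Coterm V)) (hx : xs.length = σs.length) :
      Red (((Coterm.const (Rule.R σs σ τ)).app t).apps (xs ++ [x])) (t.apps (xs ++ [x]))
  | condZero (σs : List Ty) (τ : Ty) (s t : Coterm V)
      (xs : List (Coterm V)) (hx : xs.length = σs.length) :
      Red ((((Coterm.const (Rule.cond σs τ)).app s).app t).apps
          (xs ++ [Coterm.const Rule.zero]))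
        (s.apps xs)
  | condSucc (σs : List Ty) (τ : Ty) (s t y : Coterm V)
      (xs : List (Coterm V)) (hx : xs.length = σs.length) :
      Red ((((Coterm.const (Rule.cond σs τ)).app s).app t).apps
          (xs ++ [(Coterm.const Rule.succ).app y]))
        (t.apps (xs ++ [y]))
  | appLeft {t t' : Coterm V} (s : Coterm V) (h : Red t t') : Red (t.app s) (t'.app s)
  | appRight (t : Coterm V) {s s' : Coterm V} (h : Red s s') : Red (t.app s) (t.app s')

/-- The farcs of type `σ` with variables from `V`. -/
def Farc (V : Ty → Type) (σ : Ty) : Type := {t : Coterm V // IsFarc σ t}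

/-- Application of farcs. -/
def Farc.app {V : Ty → Type} {σ τ : Ty} (t : Farc V (Ty.arr σ τ)) (s : Farc V σ) : Farc V τ :=
  ⟨Coterm.app t.1 s.1, IsFarc.app t.2 s.2⟩

/-- Constants as farcs. -/
def Farc.const (V : Ty → Type) (r : Rule) : Farc V r.toTy := ⟨Coterm.const r, IsFarc.const r⟩

/-- The numeral `succ (⋯ (succ 0))`. -/
def numeral (V : Ty → Type) : ℕ → Farc V Ty.N
  | 0 => Farc.const V Rule.zero
  | n + 1 => Farc.app (σ := Ty.N) (τ := Ty.N) (Farc.const V Rule.succ) (numeral V n)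

/-- Conversion of farcs: the equivalence relation generated by reduction. -/
def Conv {V : Ty → Type} {σ : Ty} : Farc V σ → Farc V σ → Prop :=
  Relation.EqvGen fun s t => Red s.1 t.1

/-- Hereditarily total farcs. -/
def HRset (V : Ty → Type) : (σ : Ty) → Set (Farc V σ)
  | Ty.N => {t | ∃ n : ℕ, Conv t (numeral V n)}
  | Ty.arr σ τ => {t | ∀ s, s ∈ HRset V σ → t.app s ∈ HRset V τ}

/-- Extensional equality of farcs. -/
def ExtEq (V : Ty → Type) : (σ : Ty) → Farc V σ → Farc V σ → Prop
  | Ty.N => fun t t' => Conv t t'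
  | Ty.arr σ τ => fun t t' => ∀ s, s ∈ HRset V σ → ExtEq V τ (t.app s) (t'.app s)

/-! ## The language of `CT` -/

/-- The constants of `CT`: the individual steps, and all regular progressing coderivations. -/
inductive CTConst : Ty → Type
  | rule (r : Rule) : CTConst r.toTy
  | coder (d : RuleTree) (hd : d.IsCoderivation) (hr : d.IsRegular) (hp : d.IsProgressing) :
      CTConst d.sequent.toTy

/-- Variables in a typing context (a list of types). -/
inductive Var : List Ty → Ty → Type
  | zero {Γ : List Ty} {σ : Ty} : Var (σ :: Γ) σ
  | succ {Γ : List Ty} {σ ρ : Ty} (v : Var Γ σ) : Var (ρ :: Γ) σ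

/-- Terms of `CT` with free variables in the context `Γ`. -/
inductive CTTerm (Γ : List Ty) : Ty → Type
  | var {σ : Ty} (v : Var Γ σ) : CTTerm Γ σ
  | const {σ : Ty} (c : CTConst σ) : CTTerm Γ σ
  | app {σ τ : Ty} (t : CTTerm Γ (Ty.arr σ τ)) (s : CTTerm Γ σ) : CTTerm Γ τ

/-- The coterm of a constant of `CT`. -/
def CTConst.toCoterm (V : Ty → Type) {σ : Ty} : CTConst σ → Coterm V
  | .rule r => Coterm.const r
  | .coder d _ _ _ => d.toCoterm V

theorem CTConst.isFarc (V : Ty → Type) {σ : Ty} (c : CTConst σ) : IsFarc σ (c.toCoterm V) := by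
  cases c with
  | rule r => exact IsFarc.const r
  | coder d hd hr hp => exact IsFarc.coder d hd hr

/-- The coterm that a term of `CT` is identified with. -/
def CTTerm.toCoterm {Γ : List Ty} : {σ : Ty} → CTTerm Γ σ → Coterm (Var Γ)
  | _, .var v => Coterm.var v
  | _, .const c => c.toCoterm (Var Γ)
  | _, .app t s => Coterm.app t.toCoterm s.toCoterm

/-- The constant of `CT` given by a step. -/
def CTTerm.step {Γ : List Ty} (r : Rule) : CTTerm Γ r.toTy := .const (.rule r)

/-- The term `0`. -/
def CTTerm.zero {Γ : List Ty} : CTTerm Γ Ty.N := CTTerm.step Rule.zero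

/-- The term `succ t`. -/
def CTTerm.succ {Γ : List Ty} (t : CTTerm Γ Ty.N) : CTTerm Γ Ty.N :=
  CTTerm.app (σ := Ty.N) (τ := Ty.N) (CTTerm.step Rule.succ) t

/-- Lists of terms of given types. -/
inductive Args (Γ : List Ty) : List Ty → Type
  | nil : Args Γ []
  | cons {σ : Ty} {σs : List Ty} (x : CTTerm Γ σ) (xs : Args Γ σs) : Args Γ (σ :: σs)

/-- Concatenation of lists of terms. -/
def Args.append {Γ : List Ty} : {σs ρs : List Ty} → Args Γ σs → Args Γ ρs → Args Γ (σs ++ ρs)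
  | _, _, .nil, ys => ys
  | _, _, .cons x xs, ys => .cons x (xs.append ys)

/-- `xs` followed by one more term. -/
def Args.snoc {Γ : List Ty} {σs : List Ty} {σ : Ty} (xs : Args Γ σs) (x : CTTerm Γ σ) :
    Args Γ (σs ++ [σ]) := xs.append (.cons x .nil)

/-- Iterated application `t x₁ ⋯ xₙ`. -/
def CTTerm.apps {Γ : List Ty} {τ : Ty} :
    {σs : List Ty} → CTTerm Γ (arrows σs τ) → Args Γ σs → CTTerm Γ τ
  | _, t, .nil => t
  | _, t, .cons x xs => CTTerm.apps (CTTerm.app t x) xs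

/-- First-order formulas (over all sorts) with free variables in the context `Γ`. -/
inductive Formula : List Ty → Type
  | eq {Γ : List Ty} {σ : Ty} (s t : CTTerm Γ σ) : Formula Γ
  | bot {Γ : List Ty} : Formula Γ
  | imp {Γ : List Ty} (φ ψ : Formula Γ) : Formula Γ
  | and {Γ : List Ty} (φ ψ : Formula Γ) : Formula Γ
  | or {Γ : List Ty} (φ ψ : Formula Γ) : Formula Γ
  | all {Γ : List Ty} (σ : Ty) (φ : Formula (σ :: Γ)) : Formula Γ
  | ex {Γ : List Ty} (σ : Ty) (φ : Formula (σ :: Γ)) : Formula Γ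

/-- Negation. -/
def Formula.neg {Γ : List Ty} (φ : Formula Γ) : Formula Γ := .imp φ .bot

/-- Quantifier-free formulas. -/
def Formula.QuantifierFree : {Γ : List Ty} → Formula Γ → Prop
  | _, .eq _ _ => True
  | _, .bot => True
  | _, .imp φ ψ => φ.QuantifierFree ∧ ψ.QuantifierFree
  | _, .and φ ψ => φ.QuantifierFree ∧ ψ.QuantifierFree
  | _, .or φ ψ => φ.QuantifierFree ∧ ψ.QuantifierFree
  | _, .all _ _ => False
  | _, .ex _ _ => False

/-- Simultaneous substitutions of terms for variables. -/
def Subst (Γ Δ : List Ty) : Type := ∀ σ : Ty, Var Γ σ → CTTerm Δ σ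

/-- Substitution in terms. -/
def CTTerm.subst {Γ Δ : List Ty} (θ : Subst Γ Δ) : {σ : Ty} → CTTerm Γ σ → CTTerm Δ σ
  | _, .var v => θ _ v
  | _, .const c => .const c
  | _, .app t s => .app (t.subst θ) (s.subst θ)

/-- The substitution that weakens the context by one variable. -/
def Subst.weaken (Γ : List Ty) (ρ : Ty) : Subst Γ (ρ :: Γ) := fun _ v => .var (.succ v)

/-- Extension of a substitution by a term for a new variable. -/
def Subst.cons {Γ Δ : List Ty} {ρ : Ty} (t : CTTerm Δ ρ) (θ : Subst Γ Δ) : Subst (ρ :: Γ) Δ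
  | _, .zero => t
  | _, .succ v => θ _ v

/-- The identity substitution. -/
def Subst.refl (Γ : List Ty) : Subst Γ Γ := fun _ v => .var v

/-- A substitution taken under a binder. -/
def Subst.lift {Γ Δ : List Ty} (ρ : Ty) (θ : Subst Γ Δ) : Subst (ρ :: Γ) (ρ :: Δ) :=
  Subst.cons (.var .zero) fun σ v => (θ σ v).subst (Subst.weaken Δ ρ)

/-- Substitution in formulas. -/
def Formula.subst : {Γ Δ : List Ty} → Subst Γ Δ → Formula Γ → Formula Δ
  | _, _, θ, .eq s t => .eq (s.subst θ) (t.subst θ)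
  | _, _, _, .bot => .bot
  | _, _, θ, .imp φ ψ => .imp (φ.subst θ) (ψ.subst θ)
  | _, _, θ, .and φ ψ => .and (φ.subst θ) (ψ.subst θ)
  | _, _, θ, .or φ ψ => .or (φ.subst θ) (ψ.subst θ)
  | _, _, θ, .all σ φ => .all σ (φ.subst (θ.lift σ))
  | _, _, θ, .ex σ φ => .ex σ (φ.subst (θ.lift σ))

/-- `φ(t)`, for a formula `φ(x)` with a distinguished variable `x`. -/
def Formula.inst {Γ : List Ty} {ρ : Ty} (φ : Formula (ρ :: Γ)) (t : CTTerm Γ ρ) : Formula Γ :=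
  φ.subst (Subst.cons t (Subst.refl Γ))

/-- `φ`, as a formula in a context with one more variable. -/
def Formula.weaken {Γ : List Ty} (ρ : Ty) (φ : Formula Γ) : Formula (ρ :: Γ) :=
  φ.subst (Subst.weaken Γ ρ)

/-- `φ(succ x)`, for a formula `φ(x)` with a distinguished variable `x` of type `N`. -/
def Formula.instSucc {Γ : List Ty} (φ : Formula (Ty.N :: Γ)) : Formula (Ty.N :: Γ) :=
  φ.subst (Subst.cons (CTTerm.succ (.var .zero)) (Subst.weaken Γ Ty.N))

/-! ## The theory `CT` -/

/-- The axioms of `CT`. The axiom `ident` expresses that terms are identified with coterms; for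
instance a coderivation with root step `r` and immediate sub-coderivations `d₁, …, dₖ` is the same
as `r d₁ ⋯ dₖ`. -/
inductive CTAxiom : {Γ : List Ty} → Formula Γ → Prop
  | refl {Γ : List Ty} {σ : Ty} (t : CTTerm Γ σ) : CTAxiom (.eq t t)
  | leibniz {Γ : List Ty} {σ : Ty} (s t : CTTerm Γ σ) (φ : Formula (σ :: Γ)) :
      CTAxiom (.imp (.and (.eq s t) (φ.inst s)) (φ.inst t))
  | ident {Γ : List Ty} {σ : Ty} (s t : CTTerm Γ σ) (h : s.toCoterm = t.toCoterm) :
      CTAxiom (.eq s t)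
  | id {Γ : List Ty} (σ : Ty) (x : CTTerm Γ σ) :
      CTAxiom (.eq (CTTerm.app (σ := σ) (τ := σ) (CTTerm.step (Rule.id σ)) x) x)
  | ex {Γ : List Ty} (ρs : List Ty) (ρ σ : Ty) (σs : List Ty) (τ : Ty)
      (t : CTTerm Γ (arrows (ρs ++ σ :: ρ :: σs) τ))
      (xs : Args Γ ρs) (x : CTTerm Γ ρ) (y : CTTerm Γ σ) (ys : Args Γ σs) :
      CTAxiom (.eq
        (CTTerm.apps (σs := ρs ++ ρ :: σ :: σs) (τ := τ)
          (CTTerm.app (CTTerm.step (Rule.ex ρs ρ σ σs τ)) t)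
          (xs.append (.cons x (.cons y ys))))
        (t.apps (xs.append (.cons y (.cons x ys)))))
  | wk {Γ : List Ty} (σs : List Ty) (σ τ : Ty)
      (t : CTTerm Γ (arrows σs τ)) (xs : Args Γ σs) (x : CTTerm Γ σ) :
      CTAxiom (.eq
        (CTTerm.apps (σs := σs ++ [σ]) (τ := τ)
          (CTTerm.app (CTTerm.step (Rule.wk σs σ τ)) t) (xs.snoc x))
        (t.apps xs))
  | cntr {Γ : List Ty} (σs : List Ty) (σ τ : Ty)
      (t : CTTerm Γ (arrows (σs ++ [σ, σ]) τ)) (xs : Args Γ σs) (x : CTTerm Γ σ) :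
      CTAxiom (.eq
        (CTTerm.apps (σs := σs ++ [σ]) (τ := τ)
          (CTTerm.app (CTTerm.step (Rule.cntr σs σ τ)) t) (xs.snoc x))
        (t.apps (xs.append (.cons x (.cons x .nil)))))
  | cut {Γ : List Ty} (σs : List Ty) (σ τ : Ty)
      (s : CTTerm Γ (arrows σs σ)) (t : CTTerm Γ (arrows (σs ++ [σ]) τ)) (xs : Args Γ σs) :
      CTAxiom (.eq
        (CTTerm.apps (σs := σs) (τ := τ)
          (CTTerm.app (CTTerm.app (CTTerm.step (Rule.cut σs σ τ)) s) t) xs)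
        (t.apps (xs.snoc (s.apps xs))))
  | L {Γ : List Ty} (σs : List Ty) (ρ σ τ : Ty)
      (s : CTTerm Γ (arrows σs ρ)) (t : CTTerm Γ (arrows (σs ++ [σ]) τ))
      (xs : Args Γ σs) (y : CTTerm Γ (Ty.arr ρ σ)) :
      CTAxiom (.eq
        (CTTerm.apps (σs := σs ++ [Ty.arr ρ σ]) (τ := τ)
          (CTTerm.app (CTTerm.app (CTTerm.step (Rule.L σs ρ σ τ)) s) t) (xs.snoc y))
        (t.apps (xs.snoc (y.app (s.apps xs)))))
  | R {Γ : List Ty} (σs : List Ty) (σ τ : Ty)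
      (t : CTTerm Γ (arrows (σs ++ [σ]) τ)) (xs : Args Γ σs) (x : CTTerm Γ σ) :
      CTAxiom (.eq
        (CTTerm.app
          (CTTerm.apps (σs := σs) (τ := Ty.arr σ τ)
            (CTTerm.app (CTTerm.step (Rule.R σs σ τ)) t) xs) x)
        (t.apps (xs.snoc x)))
  | condZero {Γ : List Ty} (σs : List Ty) (τ : Ty)
      (s : CTTerm Γ (arrows σs τ)) (t : CTTerm Γ (arrows (σs ++ [Ty.N]) τ)) (xs : Args Γ σs) :
      CTAxiom (.eq
        (CTTerm.apps (σs := σs ++ [Ty.N]) (τ := τ)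
          (CTTerm.app (CTTerm.app (CTTerm.step (Rule.cond σs τ)) s) t) (xs.snoc CTTerm.zero))
        (s.apps xs))
  | condSucc {Γ : List Ty} (σs : List Ty) (τ : Ty)
      (s : CTTerm Γ (arrows σs τ)) (t : CTTerm Γ (arrows (σs ++ [Ty.N]) τ)) (xs : Args Γ σs)
      (y : CTTerm Γ Ty.N) :
      CTAxiom (.eq
        (CTTerm.apps (σs := σs ++ [Ty.N]) (τ := τ)
          (CTTerm.app (CTTerm.app (CTTerm.step (Rule.cond σs τ)) s) t) (xs.snoc y.succ))
        (t.apps (xs.snoc y)))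
  | succ_ne_zero {Γ : List Ty} (x : CTTerm Γ Ty.N) :
      CTAxiom (Formula.neg (.eq x.succ CTTerm.zero))
  | succ_inj {Γ : List Ty} (x y : CTTerm Γ Ty.N) :
      CTAxiom (.imp (.eq x.succ y.succ) (.eq x y))

/-- The premiss of the extensionality rule for `s`, `t`: the formula `s x = t x`, for a fresh
variable `x`. -/
def extPremise {Γ : List Ty} {σ τ : Ty} (s t : CTTerm Γ (Ty.arr σ τ)) : Formula (σ :: Γ) :=
  .eq ((s.subst (Subst.weaken Γ σ)).app (.var .zero))
    ((t.subst (Subst.weaken Γ σ)).app (.var .zero))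

/-- Derivability from hypotheses: classical first-order natural deduction from the axioms of `CT`,
with the rule of quantifier-free induction and, if `ER` holds, the extensionality rule.
`Proves True` is `CT`, and `Proves False` is `CT` without extensionality. -/
inductive Proves (ER : Prop) : {Γ : List Ty} → List (Formula Γ) → Formula Γ → Prop
  | ax {Γ : List Ty} {H : List (Formula Γ)} {φ : Formula Γ} (h : CTAxiom φ) : Proves ER H φ
  | ind {Γ : List Ty} {H : List (Formula Γ)} (φ : Formula (Ty.N :: Γ)) (hφ : φ.QuantifierFree)
      (h0 : Proves ER [] (φ.inst CTTerm.zero)) (h1 : Proves ER [] (.imp φ φ.instSucc))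
      (t : CTTerm Γ Ty.N) : Proves ER H (φ.inst t)
  | ext {Γ : List Ty} {H : List (Formula Γ)} {σ τ : Ty} (her : ER)
      (s t : CTTerm Γ (Ty.arr σ τ)) (h : Proves ER [] (extPremise s t)) : Proves ER H (.eq s t)
  | subst {Γ Δ : List Ty} {H : List (Formula Δ)} {φ : Formula Γ} (θ : Subst Γ Δ)
      (h : Proves ER [] φ) : Proves ER H (φ.subst θ)
  | hyp {Γ : List Ty} {H : List (Formula Γ)} {φ : Formula Γ} (h : φ ∈ H) : Proves ER H φ
  | byContra {Γ : List Ty} {H : List (Formula Γ)} {φ : Formula Γ}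
      (h : Proves ER (φ.neg :: H) .bot) : Proves ER H φ
  | impI {Γ : List Ty} {H : List (Formula Γ)} {φ ψ : Formula Γ}
      (h : Proves ER (φ :: H) ψ) : Proves ER H (.imp φ ψ)
  | impE {Γ : List Ty} {H : List (Formula Γ)} {φ ψ : Formula Γ}
      (h : Proves ER H (.imp φ ψ)) (h' : Proves ER H φ) : Proves ER H ψ
  | andI {Γ : List Ty} {H : List (Formula Γ)} {φ ψ : Formula Γ}
      (h : Proves ER H φ) (h' : Proves ER H ψ) : Proves ER H (.and φ ψ)
  | andE₁ {Γ : List Ty} {H : List (Formula Γ)} {φ ψ : Formula Γ}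
      (h : Proves ER H (.and φ ψ)) : Proves ER H φ
  | andE₂ {Γ : List Ty} {H : List (Formula Γ)} {φ ψ : Formula Γ}
      (h : Proves ER H (.and φ ψ)) : Proves ER H ψ
  | orI₁ {Γ : List Ty} {H : List (Formula Γ)} {φ ψ : Formula Γ}
      (h : Proves ER H φ) : Proves ER H (.or φ ψ)
  | orI₂ {Γ : List Ty} {H : List (Formula Γ)} {φ ψ : Formula Γ}
      (h : Proves ER H ψ) : Proves ER H (.or φ ψ)
  | orE {Γ : List Ty} {H : List (Formula Γ)} {φ ψ χ : Formula Γ} (h : Proves ER H (.or φ ψ))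
      (h₁ : Proves ER (φ :: H) χ) (h₂ : Proves ER (ψ :: H) χ) : Proves ER H χ
  | allI {Γ : List Ty} {H : List (Formula Γ)} {σ : Ty} {φ : Formula (σ :: Γ)}
      (h : Proves ER (H.map (Formula.weaken σ)) φ) : Proves ER H (.all σ φ)
  | allE {Γ : List Ty} {H : List (Formula Γ)} {σ : Ty} {φ : Formula (σ :: Γ)}
      (h : Proves ER H (.all σ φ)) (t : CTTerm Γ σ) : Proves ER H (φ.inst t)
  | exI {Γ : List Ty} {H : List (Formula Γ)} {σ : Ty} {φ : Formula (σ :: Γ)}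
      (t : CTTerm Γ σ) (h : Proves ER H (φ.inst t)) : Proves ER H (.ex σ φ)
  | exE {Γ : List Ty} {H : List (Formula Γ)} {σ : Ty} {φ : Formula (σ :: Γ)} {χ : Formula Γ}
      (h : Proves ER H (.ex σ φ))
      (h' : Proves ER (φ :: H.map (Formula.weaken σ)) (χ.weaken σ)) : Proves ER H χ

/-! ## Type structures and models -/

/-- The data of a type structure for the language of `CT`: for each type a domain, given as a
subset of some ambient set; application; an interpretation of the constants; and an interpretation
of equality at each type, which need not be true equality. -/
structure StructureData : Type 1 where
  U : Ty → Type
  dom : ∀ σ : Ty, Set (U σ)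
  app : ∀ {σ τ : Ty}, U (Ty.arr σ τ) → U σ → U τ
  const : ∀ {σ : Ty}, CTConst σ → U σ
  eq : ∀ {σ : Ty}, U σ → U σ → Prop

namespace StructureData

/-- The domains are non-empty, contain the constants and are closed under application. -/
structure IsTypeStructure (M : StructureData) : Prop where
  nonempty : ∀ σ : Ty, (M.dom σ).Nonempty
  app_mem : ∀ {σ τ : Ty} (t : M.U (Ty.arr σ τ)) (s : M.U σ),
    t ∈ M.dom (Ty.arr σ τ) → s ∈ M.dom σ → M.app t s ∈ M.dom τ
  const_mem : ∀ {σ : Ty} (c : CTConst σ), M.const c ∈ M.dom σ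

/-- Assignments of elements of the domains to the variables in a context. -/
def Assignment (M : StructureData) (Γ : List Ty) : Type := ∀ σ : Ty, Var Γ σ → M.dom σ

/-- Extension of an assignment to one more variable. -/
def Assignment.cons {M : StructureData} {Γ : List Ty} {ρ : Ty} (x : M.dom ρ)
    (a : M.Assignment Γ) : M.Assignment (ρ :: Γ)
  | _, .zero => x
  | _, .succ v => a _ v

/-- The value of a term. -/
def eval (M : StructureData) {Γ : List Ty} (a : M.Assignment Γ) : {σ : Ty} → CTTerm Γ σ → M.U σ
  | _, .var v => (a _ v).1
  | _, .const c => M.const c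
  | _, .app t s => M.app (M.eval a t) (M.eval a s)

/-- Truth of a formula under an assignment; quantifiers range over the domains. -/
def Sat (M : StructureData) : {Γ : List Ty} → M.Assignment Γ → Formula Γ → Prop
  | _, a, .eq s t => M.eq (M.eval a s) (M.eval a t)
  | _, _, .bot => False
  | _, a, .imp φ ψ => M.Sat a φ → M.Sat a ψ
  | _, a, .and φ ψ => M.Sat a φ ∧ M.Sat a ψ
  | _, a, .or φ ψ => M.Sat a φ ∨ M.Sat a ψ
  | _, a, .all σ φ => ∀ x : M.dom σ, M.Sat (a.cons x) φ
  | _, a, .ex σ φ => ∃ x : M.dom σ, M.Sat (a.cons x) φ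

/-- Truth of a formula under all assignments. -/
def Valid (M : StructureData) {Γ : List Ty} (φ : Formula Γ) : Prop :=
  ∀ a : M.Assignment Γ, M.Sat a φ

/-- `M` is a model of `CT` (if `ER` holds), respectively of `CT` without extensionality (if `ER`
does not hold): it is a type structure, its valid formulas are closed under the rules of induction
and (if `ER` holds) of extensionality, and all theorems are valid in it. -/
structure IsModel (M : StructureData) (ER : Prop) : Prop where
  isTypeStructure : M.IsTypeStructure
  ind : ∀ {Γ : List Ty} (φ : Formula (Ty.N :: Γ)), φ.QuantifierFree →
    M.Valid (φ.inst CTTerm.zero) → M.Valid (Formula.imp φ φ.instSucc) →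
    ∀ t : CTTerm Γ Ty.N, M.Valid (φ.inst t)
  ext : ER → ∀ {Γ : List Ty} {σ τ : Ty} (s t : CTTerm Γ (Ty.arr σ τ)),
    M.Valid (extPremise s t) → M.Valid (Formula.eq s t)
  theorems : ∀ {Γ : List Ty} (φ : Formula Γ), Proves ER [] φ → M.Valid φ

end StructureData

/-- The structure `HR`: hereditarily total farcs, with equality interpreted by conversion. -/
def HR (V : Ty → Type) : StructureData where
  U := Farc V
  dom := HRset V
  app := Farc.app
  const := fun c => ⟨c.toCoterm V, c.isFarc V⟩
  eq := Conv

/-- The structure `HE`: as `HR`, with equality interpreted by extensional equality. -/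
def HE (V : Ty → Type) : StructureData where
  U := Farc V
  dom := HRset V
  app := Farc.app
  const := fun c => ⟨c.toCoterm V, c.isFarc V⟩
  eq := fun {σ} => ExtEq V σ

end CircularT

/-!
Hereditarily total farcs form a model because of three facts: every regular progressing coderivation
is hereditarily total, conversion between farcs of type `N` preserves numerical values, and (for
`HE`) hereditarily total farcs respect extensional equality. The soundness of first-order reasoning
is then routine.

*Values.* A term of type `N` is evaluated lazily by weak head reduction (`Ev`), and what can be
learnt about it in finitely many contractions is recorded by observations (`Obs`). A step-indexed
logical relation `Rel` compares the observations on two terms. Its fundamental theorem `IsFarc.rel`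
holds for all farcs, progressing or not, since unfolding a coderivation takes a contraction and so
lowers the index. As both sides of a head contraction have the same observations, the two sides of
any reduction are related in both directions (`Red.rel`). Hence a farc of type `N` converts to a
numeral if and only if it evaluates to it (`conv_numeral_iff`), and distinct numerals do not
convert to each other; confluence is not needed.

*Totality.* If a step applied to premisses and hereditarily total arguments is not hereditarily
total, then neither is one of its premisses at suitable hereditarily total arguments, and numerical
arguments keep their values along immediate ancestry, except that the principal argument of `cond`
drops by one (`exists_premise_not_tot`). A regular progressing coderivation that is not hereditarily
total would therefore have an infinite branch with a thread of natural numbers that decreases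
infinitely often (`RuleTree.tot`).

*Extensionality.* Let `t` be a hereditarily total farc, and let `f` and `g` be extensionally equal
hereditarily total arguments. A regular coderivation that tests two numbers for equality, and
diverges if they differ, gives the pointwise meet of `f` and `g`, with value `f x` if `f x = g x`
and undefined otherwise. It is hereditarily total and lies below both `f` and `g` in the logical
relation, so the values of `t` at `f` and at `g` both lie above its value at the meet, which is
total. So all three agree (`extEq_app`).
-/

namespace CircularT

variable {V : Ty → Type}

open Coterm

/-! ### Coterms and their types -/

namespace Coterm

theorem app_inj {t s t' s' : Coterm V} (h : app t s = app t' s') : t = t' ∧ s = s' := by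
  have h' := eq_of_heq (Sigma.mk.inj (PFunctor.M.mk_inj h)).2
  exact ⟨congrFun h' false, congrFun h' true⟩

theorem const_inj {r r' : Rule} (h : (const r : Coterm V) = const r') : r = r' := by
  have h' := (Sigma.mk.inj (PFunctor.M.mk_inj h)).1
  exact CoLabel.const.inj h'

theorem var_inj {σ τ : Ty} {v : V σ} {w : V τ} (h : var v = var w) : σ = τ ∧ HEq v w := by
  have h' := (Sigma.mk.inj (PFunctor.M.mk_inj h)).1
  exact CoLabel.var.inj h'

theorem app_ne_const {t s : Coterm V} {r : Rule} : app t s ≠ const r := fun h => by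
  have h' := (Sigma.mk.inj (PFunctor.M.mk_inj h)).1
  cases h'

theorem app_ne_var {t s : Coterm V} {σ : Ty} {v : V σ} : app t s ≠ var v := fun h => by
  have h' := (Sigma.mk.inj (PFunctor.M.mk_inj h)).1
  cases h'

theorem const_ne_var {r : Rule} {σ : Ty} {v : V σ} : const r ≠ var v := fun h => by
  have h' := (Sigma.mk.inj (PFunctor.M.mk_inj h)).1
  cases h'

theorem apps_append (t : Coterm V) (l m : List (Coterm V)) :
    t.apps (l ++ m) = (t.apps l).apps m := by
  induction l generalizing t with
  | nil => rfl
  | cons x l ih => exact ih _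

theorem apps_snoc (t : Coterm V) (l : List (Coterm V)) (x : Coterm V) :
    t.apps (l ++ [x]) = (t.apps l).app x := by
  rw [apps_append]; rfl

theorem const_apps_inj {r r' : Rule} {l l' : List (Coterm V)}
    (h : (const r).apps l = (const r').apps l') : r = r' ∧ l = l' := by
  induction l using List.reverseRecOn generalizing l' with
  | nil =>
    rcases List.eq_nil_or_concat l' with rfl | ⟨m, y, rfl⟩
    · exact ⟨const_inj h, rfl⟩
    · rw [List.concat_eq_append, apps_snoc] at h
      exact (app_ne_const h.symm).elim
  | append_singleton l x ih =>
    rcases List.eq_nil_or_concat l' with rfl | ⟨m, y, rfl⟩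
    · rw [apps_snoc] at h
      exact (app_ne_const h).elim
    · rw [List.concat_eq_append, apps_snoc, apps_snoc] at h
      obtain ⟨h1, rfl⟩ := app_inj h
      obtain ⟨rfl, rfl⟩ := ih h1
      exact ⟨rfl, by simp⟩

theorem var_apps_ne {r : Rule} {σ : Ty} {v : V σ} {l l' : List (Coterm V)} :
    (var v).apps l ≠ (const r).apps l' := by
  induction l using List.reverseRecOn generalizing l' with
  | nil =>
    rcases List.eq_nil_or_concat l' with rfl | ⟨m, y, rfl⟩
    · exact const_ne_var.symm
    · rw [List.concat_eq_append, apps_snoc]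
      exact app_ne_var.symm
  | append_singleton l x ih =>
    rcases List.eq_nil_or_concat l' with rfl | ⟨m, y, rfl⟩
    · rw [apps_snoc]
      exact app_ne_const
    · rw [List.concat_eq_append, apps_snoc, apps_snoc]
      exact fun h => ih (app_inj h).1

end Coterm

theorem Spine.toCoterm_eq_apps (V : Ty → Type) (d : RuleTree) (k : ℕ)
    (h : k ≤ d.rule.premises.length) :
    Spine.toCoterm V ⟨d, k, h⟩ = (Coterm.const d.rule).apps
      (List.ofFn fun i : Fin k => (d.child ⟨i, i.2.trans_le h⟩).toCoterm V) := by
  induction k with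
  | zero => rw [Spine.toCoterm_zero]; simp [Coterm.apps]
  | succ k ih =>
    rw [Spine.toCoterm_succ, ih, List.ofFn_succ', List.concat_eq_append, Coterm.apps_snoc]
    rfl

/-- The coterm of a coderivation with root step `r` is `r` applied to the coterms of the immediate
sub-coderivations. -/
theorem RuleTree.toCoterm_eq_apps (V : Ty → Type) (d : RuleTree) :
    d.toCoterm V = (Coterm.const d.rule).apps
      (List.ofFn fun i : Fin d.rule.premises.length => (d.child i).toCoterm V) :=
  Spine.toCoterm_eq_apps V d _ le_rfl

theorem arrows_append (Γ Δ : List Ty) (τ : Ty) : arrows (Γ ++ Δ) τ = arrows Γ (arrows Δ τ) := by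
  induction Γ with
  | nil => rfl
  | cons σ Γ ih => simp [arrows, ih]

theorem arrows_inj {Γ Δ : List Ty} {σ τ : Ty} (hl : Γ.length = Δ.length)
    (h : arrows Γ σ = arrows Δ τ) : Γ = Δ ∧ σ = τ := by
  induction Γ generalizing Δ with
  | nil => cases Δ with
    | nil => exact ⟨rfl, h⟩
    | cons _ _ => simp at hl
  | cons ρ Γ ih => cases Δ with
    | nil => simp at hl
    | cons ρ' Δ =>
      simp only [arrows, Ty.arr.injEq] at h
      obtain ⟨rfl, rfl⟩ := ih (by simpa using hl) h.2
      exact ⟨by rw [h.1], rfl⟩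

theorem exists_eq_arrows (σ : Ty) : ∃ Γ, σ = arrows Γ Ty.N := by
  induction σ with
  | N => exact ⟨[], rfl⟩
  | arr σ τ _ ih => obtain ⟨Γ, rfl⟩ := ih; exact ⟨σ :: Γ, rfl⟩

theorem Rule.toTy_eq (r : Rule) :
    r.toTy = arrows (r.premises.map Sequent.toTy ++ r.conclusion.ctx) r.conclusion.goal := by
  rw [arrows_append]; rfl

theorem forall₂_append_inv {α β : Type*} {R : α → β → Prop} {l₁ l₂ : List α} {m : List β}
    (h : List.Forall₂ R (l₁ ++ l₂) m) :
    ∃ m₁ m₂, m = m₁ ++ m₂ ∧ List.Forall₂ R l₁ m₁ ∧ List.Forall₂ R l₂ m₂ := by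
  induction l₁ generalizing m with
  | nil => exact ⟨[], m, rfl, .nil, h⟩
  | cons a l₁ ih =>
    cases h with
    | cons h1 h2 =>
      obtain ⟨m₁, m₂, rfl, h3, h4⟩ := ih h2
      exact ⟨_ :: m₁, m₂, rfl, .cons h1 h3, h4⟩

theorem forall₂_append {α β : Type*} {R : α → β → Prop} {l₁ l₂ : List α} {m₁ m₂ : List β}
    (h₁ : List.Forall₂ R l₁ m₁) (h₂ : List.Forall₂ R l₂ m₂) :
    List.Forall₂ R (l₁ ++ l₂) (m₁ ++ m₂) := List.rel_append h₁ h₂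

namespace RuleTree

theorem IsSub.trans_child {d e : RuleTree} (i : Fin d.rule.premises.length)
    (h : (d.child i).IsSub e) : d.IsSub e :=
  Relation.ReflTransGen.head ⟨i, i.2, rfl⟩ h

theorem IsCoderivation.child {d : RuleTree} (hd : d.IsCoderivation)
    (i : Fin d.rule.premises.length) : (d.child i).IsCoderivation :=
  fun e he => hd e (IsSub.trans_child i he)

theorem IsRegular.child {d : RuleTree} (hd : d.IsRegular)
    (i : Fin d.rule.premises.length) : (d.child i).IsRegular :=
  Set.Finite.subset hd fun _ he => IsSub.trans_child i he

theorem IsCoderivation.sequent_child {d : RuleTree} (hd : d.IsCoderivation)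
    (i : Fin d.rule.premises.length) : (d.child i).sequent = d.rule.premises.get i :=
  hd d .refl i

theorem children_forall₂ {d : RuleTree} (R : Ty → Coterm V → Prop) (hd : d.IsCoderivation)
    (h : ∀ i, R (d.child i).sequent.toTy ((d.child i).toCoterm V)) :
    List.Forall₂ R (d.rule.premises.map Sequent.toTy)
      (List.ofFn fun i : Fin d.rule.premises.length => (d.child i).toCoterm V) := by
  rw [List.forall₂_iff_get]
  refine ⟨by simp, fun i h₁ h₂ => ?_⟩
  have := h ⟨i, by simpa using h₁⟩
  rw [hd.sequent_child] at this
  simpa using this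

end RuleTree

theorem Spine.isFarc (d : RuleTree) (hd : d.IsCoderivation) (hr : d.IsRegular) (k : ℕ)
    (h : k ≤ d.rule.premises.length) :
    IsFarc (arrows ((d.rule.premises.map Sequent.toTy).drop k) d.sequent.toTy)
      (Spine.toCoterm V ⟨d, k, h⟩) := by
  induction k with
  | zero => rw [Spine.toCoterm_zero]; exact IsFarc.const d.rule
  | succ k ih =>
    rw [Spine.toCoterm_succ]
    have h1 := ih (Nat.le_of_succ_le h)
    rw [List.drop_eq_getElem_cons (by simpa using h)] at h1
    refine IsFarc.app h1 ?_
    have h2 : IsFarc (V := V) _ _ := IsFarc.coder _ (hd.child ⟨k, h⟩) (hr.child ⟨k, h⟩)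
    rw [hd.sequent_child] at h2
    simpa using h2

theorem IsFarc.app_inv {τ : Ty} {t s : Coterm V} (h : IsFarc τ (t.app s)) :
    ∃ σ, IsFarc (Ty.arr σ τ) t ∧ IsFarc σ s := by
  generalize hu : t.app s = u at h
  cases h with
  | var v => exact (Coterm.app_ne_var hu).elim
  | const r => exact (Coterm.app_ne_const hu).elim
  | app ht hs => obtain ⟨rfl, rfl⟩ := Coterm.app_inj hu; exact ⟨_, ht, hs⟩
  | coder d hd hr =>
    unfold RuleTree.toCoterm Spine.full at hu
    rcases hk : d.rule.premises.length with _ | k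
    · simp only [hk] at hu
      rw [Spine.toCoterm_zero] at hu
      exact (Coterm.app_ne_const hu).elim
    · simp only [hk] at hu
      rw [Spine.toCoterm_succ] at hu
      obtain ⟨rfl, rfl⟩ := Coterm.app_inj hu
      have h1 := Spine.isFarc (V := V) d hd hr k (by omega)
      rw [List.drop_eq_getElem_cons (by simp; omega), List.drop_eq_nil_of_le (by simp; omega)] at h1
      refine ⟨_, h1, ?_⟩
      have h2 : IsFarc (V := V) _ _ :=
        IsFarc.coder _ (hd.child ⟨k, by omega⟩) (hr.child ⟨k, by omega⟩)
      rw [hd.sequent_child] at h2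
      simpa using h2

theorem IsFarc.const_inv {τ : Ty} {r : Rule} (h : IsFarc τ (Coterm.const r : Coterm V)) :
    τ = r.toTy := by
  generalize hu : (Coterm.const r : Coterm V) = u at h
  cases h with
  | var v => exact (Coterm.const_ne_var hu).elim
  | const r => rw [Coterm.const_inj hu]
  | app ht hs => exact (Coterm.app_ne_const hu.symm).elim
  | coder d hd hr =>
    rw [RuleTree.toCoterm_eq_apps] at hu
    obtain ⟨rfl, h⟩ := Coterm.const_apps_inj (l := []) hu
    have : d.rule.premises = [] := by
      have := congrArg List.length h
      simpa using this.symm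
    simp [Rule.toTy, this, arrows, RuleTree.sequent]

theorem IsFarc.apps_inv {τ : Ty} {t : Coterm V} {l : List (Coterm V)} (h : IsFarc τ (t.apps l)) :
    ∃ Δ, List.Forall₂ IsFarc Δ l ∧ IsFarc (arrows Δ τ) t := by
  induction l generalizing t with
  | nil => exact ⟨[], .nil, h⟩
  | cons x l ih =>
    obtain ⟨Δ, h1, h2⟩ := ih h
    obtain ⟨σ, h3, h4⟩ := h2.app_inv
    exact ⟨σ :: Δ, .cons h4 h1, h3⟩

theorem IsFarc.apps {Δ : List Ty} {τ : Ty} {t : Coterm V} {l : List (Coterm V)}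
    (ht : IsFarc (arrows Δ τ) t) (h : List.Forall₂ IsFarc Δ l) : IsFarc τ (t.apps l) := by
  induction h generalizing t with
  | nil => exact ht
  | cons h1 _ ih => exact ih (IsFarc.app ht h1)

theorem IsFarc.const_apps_inv {Δ : List Ty} {τ τ₀ : Ty} {r : Rule} {l : List (Coterm V)}
    (hr : r.toTy = arrows Δ τ₀) (hl : Δ.length = l.length)
    (h : IsFarc τ ((Coterm.const r).apps l)) : τ = τ₀ ∧ List.Forall₂ IsFarc Δ l := by
  obtain ⟨Δ', h1, h2⟩ := h.apps_inv
  obtain ⟨rfl, rfl⟩ := arrows_inj (h1.length_eq.trans hl.symm) (h2.const_inv.trans hr)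
  exact ⟨rfl, h1⟩

/-! ### Contraction and subject reduction -/

/-- `Contr r l u`: the redex consisting of the step `r`, other than `cond`, applied to exactly the
arguments `l` that its reduction rule asks for contracts to `u`. -/
inductive Contr : Rule → List (Coterm V) → Coterm V → Prop
  | id (σ : Ty) (x : Coterm V) : Contr (.id σ) [x] x
  | ex (ρs : List Ty) (ρ σ : Ty) (σs : List Ty) (τ : Ty) (t x y : Coterm V)
      (xs ys : List (Coterm V)) (hx : xs.length = ρs.length) (hy : ys.length = σs.length) :
      Contr (.ex ρs ρ σ σs τ) (t :: (xs ++ x :: y :: ys)) (t.apps (xs ++ y :: x :: ys))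
  | wk (σs : List Ty) (σ τ : Ty) (t x : Coterm V)
      (xs : List (Coterm V)) (hx : xs.length = σs.length) :
      Contr (.wk σs σ τ) (t :: (xs ++ [x])) (t.apps xs)
  | cntr (σs : List Ty) (σ τ : Ty) (t x : Coterm V)
      (xs : List (Coterm V)) (hx : xs.length = σs.length) :
      Contr (.cntr σs σ τ) (t :: (xs ++ [x])) (t.apps (xs ++ [x, x]))
  | cut (σs : List Ty) (σ τ : Ty) (s t : Coterm V)
      (xs : List (Coterm V)) (hx : xs.length = σs.length) :
      Contr (.cut σs σ τ) (s :: t :: xs) (t.apps (xs ++ [s.apps xs]))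
  | L (σs : List Ty) (ρ σ τ : Ty) (s t y : Coterm V)
      (xs : List (Coterm V)) (hx : xs.length = σs.length) :
      Contr (.L σs ρ σ τ) (s :: t :: (xs ++ [y])) (t.apps (xs ++ [y.app (s.apps xs)]))
  | R (σs : List Ty) (σ τ : Ty) (t x : Coterm V)
      (xs : List (Coterm V)) (hx : xs.length = σs.length) :
      Contr (.R σs σ τ) (t :: (xs ++ [x])) (t.apps (xs ++ [x]))

/-- Case distinction on the root of a reduction: a redex of a step other than `cond`, one of the
two redexes of `cond`, or a reduction inside an application. -/
theorem Red.induct {P : Coterm V → Coterm V → Prop}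
    (contr : ∀ r l u, Contr r l u → P ((const r).apps l) u)
    (condZero : ∀ σs τ s t (xs : List (Coterm V)), xs.length = σs.length →
      P ((const (.cond σs τ)).apps (s :: t :: (xs ++ [const .zero]))) (s.apps xs))
    (condSucc : ∀ σs τ s t y (xs : List (Coterm V)), xs.length = σs.length →
      P ((const (.cond σs τ)).apps (s :: t :: (xs ++ [(const .succ).app y]))) (t.apps (xs ++ [y])))
    (appLeft : ∀ t t' s : Coterm V, Red t t' → P t t' → P (t.app s) (t'.app s))
    (appRight : ∀ t s s' : Coterm V, Red s s' → P s s' → P (t.app s) (t.app s'))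
    (t t' : Coterm V) (h : Red t t') : P t t' := by
  induction h with
  | id σ x => exact contr _ _ _ (.id σ x)
  | ex ρs ρ σ σs τ t x y xs ys hx hy => exact contr _ _ _ (.ex ρs ρ σ σs τ t x y xs ys hx hy)
  | wk σs σ τ t x xs hx => exact contr _ _ _ (.wk σs σ τ t x xs hx)
  | cntr σs σ τ t x xs hx => exact contr _ _ _ (.cntr σs σ τ t x xs hx)
  | cut σs σ τ s t xs hx => exact contr _ _ _ (.cut σs σ τ s t xs hx)
  | L σs ρ σ τ s t y xs hx => exact contr _ _ _ (.L σs ρ σ τ s t y xs hx)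
  | R σs σ τ t x xs hx => exact contr _ _ _ (.R σs σ τ t x xs hx)
  | condZero σs τ s t xs hx => exact condZero σs τ s t xs hx
  | condSucc σs τ s t y xs hx => exact condSucc σs τ s t y xs hx
  | appLeft s h ih => exact appLeft _ _ s h ih
  | appRight t h ih => exact appRight t _ _ h ih

theorem Contr.red {r : Rule} {l : List (Coterm V)} {u : Coterm V} (h : Contr r l u) :
    Red ((const r).apps l) u := by
  cases h with
  | id σ => exact .id σ u
  | ex ρs ρ σ σs τ t x y xs ys hx hy => exact .ex ρs ρ σ σs τ t x y xs ys hx hy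
  | wk σs σ τ t x xs hx => exact .wk σs σ τ t x xs hx
  | cntr σs σ τ t x xs hx => exact .cntr σs σ τ t x xs hx
  | cut σs σ τ s t xs hx => exact .cut σs σ τ s t xs hx
  | L σs ρ σ τ s t y xs hx => exact .L σs ρ σ τ s t y xs hx
  | R σs σ τ t x xs hx => exact .R σs σ τ t x xs hx

theorem Red.apps {t t' : Coterm V} (h : Red t t') (l : List (Coterm V)) :
    Red (t.apps l) (t'.apps l) := by
  induction l generalizing t t' with
  | nil => exact h
  | cons x l ih => exact ih (h.appLeft x)

theorem forall₂_snoc_inv {α β : Type*} {R : α → β → Prop} {l : List α} {a : α} {m : List β} {b : β}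
    (h : List.Forall₂ R (l ++ [a]) (m ++ [b])) : List.Forall₂ R l m ∧ R a b := by
  obtain ⟨m₁, m₂, h1, h2, h3⟩ := forall₂_append_inv h
  cases h3 with
  | cons h4 h5 =>
    cases h5
    obtain ⟨rfl, h6⟩ := List.append_inj' h1 rfl
    obtain rfl := List.head_eq_of_cons_eq h6
    exact ⟨h2, h4⟩

theorem forall₂_snoc {α β : Type*} {R : α → β → Prop} {l : List α} {a : α} {m : List β} {b : β}
    (h : List.Forall₂ R l m) (h' : R a b) : List.Forall₂ R (l ++ [a]) (m ++ [b]) :=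
  forall₂_append h (.cons h' .nil)

theorem Contr.isFarc {r : Rule} {l : List (Coterm V)} {u : Coterm V} (h : Contr r l u) {τ : Ty}
    (ht : IsFarc τ ((const r).apps l)) : IsFarc τ u := by
  cases h with
  | id σ x =>
    obtain ⟨rfl, h⟩ := ht.const_apps_inv (Δ := [σ]) (τ₀ := σ) rfl rfl
    rcases h with _ | ⟨h, _⟩
    exact h
  | ex ρs ρ σ σs τ t x y xs ys hx hy =>
    obtain ⟨rfl, h⟩ := ht.const_apps_inv (Rule.toTy_eq _)
      (by simp [Rule.premises, Rule.conclusion, hx, hy])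
    rcases h with _ | ⟨h, h'⟩
    have h' : List.Forall₂ IsFarc (ρs ++ ρ :: σ :: σs) (xs ++ x :: y :: ys) := h'
    obtain ⟨m₁, m₂, h1, h2, h3⟩ := forall₂_append_inv h'
    obtain ⟨rfl, rfl⟩ := List.append_inj h1 (hx.trans h2.length_eq)
    rcases h3 with _ | ⟨h3, _ | ⟨h4, h5⟩⟩
    exact h.apps (forall₂_append h2 (.cons h4 (.cons h3 h5)))
  | wk σs σ τ t x xs hx =>
    obtain ⟨rfl, h⟩ := ht.const_apps_inv (Rule.toTy_eq _)
      (by simp [Rule.premises, Rule.conclusion, hx])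
    rcases h with _ | ⟨h, h'⟩
    exact h.apps (forall₂_snoc_inv h').1
  | cntr σs σ τ t x xs hx =>
    obtain ⟨rfl, h⟩ := ht.const_apps_inv (Rule.toTy_eq _)
      (by simp [Rule.premises, Rule.conclusion, hx])
    rcases h with _ | ⟨h, h'⟩
    obtain ⟨h1, h2⟩ := forall₂_snoc_inv h'
    exact h.apps (forall₂_append h1 (.cons h2 (.cons h2 .nil)))
  | cut σs σ τ s t xs hx =>
    obtain ⟨rfl, h⟩ := ht.const_apps_inv (Rule.toTy_eq _)
      (by simp [Rule.premises, Rule.conclusion, hx])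
    rcases h with _ | ⟨h, _ | ⟨h', h1⟩⟩
    exact h'.apps (forall₂_snoc h1 (h.apps h1))
  | L σs ρ σ τ s t y xs hx =>
    obtain ⟨rfl, h⟩ := ht.const_apps_inv (Rule.toTy_eq _)
      (by simp [Rule.premises, Rule.conclusion, hx])
    rcases h with _ | ⟨h, _ | ⟨h', h1⟩⟩
    obtain ⟨h1, h2⟩ := forall₂_snoc_inv h1
    exact h'.apps (forall₂_snoc h1 (.app h2 (h.apps h1)))
  | R σs σ τ t x xs hx =>
    have e : (Rule.R σs σ τ).toTy = arrows (arrows (σs ++ [σ]) τ :: (σs ++ [σ])) τ := by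
      rw [Rule.toTy_eq]
      simp [Rule.premises, Rule.conclusion, arrows, arrows_append, Sequent.toTy]
    obtain ⟨rfl, h⟩ := ht.const_apps_inv e (by simp [hx])
    rcases h with _ | ⟨h, h'⟩
    exact h.apps h'

theorem isFarc_cond_inv {σs : List Ty} {τ ρ : Ty} {s t u : Coterm V} {xs : List (Coterm V)}
    (hx : xs.length = σs.length)
    (h : IsFarc ρ ((const (.cond σs τ)).apps (s :: t :: (xs ++ [u])))) :
    ρ = τ ∧ IsFarc (arrows σs τ) s ∧ IsFarc (arrows (σs ++ [Ty.N]) τ) t ∧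
      List.Forall₂ IsFarc σs xs ∧ IsFarc Ty.N u := by
  obtain ⟨rfl, h⟩ := h.const_apps_inv (Rule.toTy_eq _)
    (by simp [Rule.premises, Rule.conclusion, hx])
  rcases h with _ | ⟨h, _ | ⟨h', h1⟩⟩
  obtain ⟨h1, h2⟩ := forall₂_snoc_inv h1
  exact ⟨rfl, h, h', h1, h2⟩

/-- Subject reduction. -/
theorem Red.isFarc {t t' : Coterm V} (h : Red t t') : ∀ {τ : Ty}, IsFarc τ t → IsFarc τ t' := by
  refine Red.induct (P := fun t t' => ∀ {τ : Ty}, IsFarc τ t → IsFarc τ t') ?_ ?_ ?_ ?_ ?_ t t' h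
  · exact fun r l u h _ ht => h.isFarc ht
  · intro σs τ s t xs hx ρ ht
    obtain ⟨rfl, h1, h2, h3, h4⟩ := isFarc_cond_inv hx ht
    exact h1.apps h3
  · intro σs τ s t y xs hx ρ ht
    obtain ⟨rfl, h1, h2, h3, h4⟩ := isFarc_cond_inv hx ht
    obtain ⟨σ, h5, h6⟩ := h4.app_inv
    cases h5.const_inv
    exact h2.apps (forall₂_snoc h3 h6)
  · intro t t' s h ih ρ ht
    obtain ⟨σ, h5, h6⟩ := ht.app_inv
    exact .app (ih h5) h6
  · intro t s s' h ih ρ ht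
    obtain ⟨σ, h5, h6⟩ := ht.app_inv
    exact .app h5 (ih h6)

/-! ### Weak head evaluation -/

theorem Contr.length_eq {r : Rule} {l l' : List (Coterm V)} {u u' : Coterm V} (h : Contr r l u)
    (h' : Contr r l' u') : l.length = l'.length := by
  cases h <;> cases h' <;> simp_all

theorem Contr.unique {r : Rule} {l : List (Coterm V)} {u u' : Coterm V} (h : Contr r l u)
    (h' : Contr r l u') : u = u' := by
  generalize hl : l = l' at h'
  cases h with
  | id σ x => cases h'; simpa using hl
  | ex ρs ρ σ σs τ t x y xs ys hx hy =>
    cases h' with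
    | ex _ _ _ _ _ t x y xs ys hx' hy' =>
      obtain ⟨rfl, h⟩ := List.cons.inj hl
      obtain ⟨rfl, h⟩ := List.append_inj h (hx.trans hx'.symm)
      simp_all
  | wk σs σ τ t x xs hx =>
    cases h' with
    | wk _ _ _ t x xs hx' =>
      obtain ⟨rfl, h⟩ := List.cons.inj hl
      obtain ⟨rfl, h⟩ := List.append_inj h (hx.trans hx'.symm)
      rfl
  | cntr σs σ τ t x xs hx =>
    cases h' with
    | cntr _ _ _ t x xs hx' =>
      obtain ⟨rfl, h⟩ := List.cons.inj hl
      obtain ⟨rfl, h⟩ := List.append_inj h (hx.trans hx'.symm)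
      simp_all
  | cut σs σ τ s t xs hx => cases h'; simp_all
  | L σs ρ σ τ s t y xs hx =>
    cases h' with
    | L _ _ _ _ s t y xs hx' =>
      obtain ⟨rfl, h1⟩ := List.cons.inj hl
      obtain ⟨rfl, h2⟩ := List.cons.inj h1
      obtain ⟨rfl, h3⟩ := List.append_inj h2 (hx.trans hx'.symm)
      simp_all
  | R σs σ τ t x xs hx =>
    cases h' with
    | R _ _ _ t x xs hx' =>
      obtain ⟨rfl, h⟩ := List.cons.inj hl
      rw [h]

/-- `Ev i t w`: weak head evaluation of `t` stops at the value `w`, which is `0` or of the form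
`succ y`, after `i` contractions. The principal argument of a `cond` is evaluated only until `0`
or a successor shows up. -/
inductive Ev : ℕ → Coterm V → Coterm V → Prop
  | zero : Ev 0 (const .zero) (const .zero)
  | succ (y : Coterm V) : Ev 0 ((const .succ).app y) ((const .succ).app y)
  | contr {i : ℕ} {r : Rule} {l : List (Coterm V)} {u : Coterm V} {w : Coterm V}
      (e : List (Coterm V)) (h : Contr r l u) (h' : Ev i (u.apps e) w) :
      Ev (i + 1) ((const r).apps (l ++ e)) w
  | condZero {i j : ℕ} {σs : List Ty} (τ : Ty) {s : Coterm V} (t : Coterm V) {u w : Coterm V}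
      {xs e : List (Coterm V)} (hx : xs.length = σs.length) (h : Ev i u (const .zero))
      (h' : Ev j (s.apps (xs ++ e)) w) :
      Ev (i + j + 1) ((const (.cond σs τ)).apps (s :: t :: (xs ++ u :: e))) w
  | condSucc {i j : ℕ} {σs : List Ty} (τ : Ty) (s : Coterm V) {t u y w : Coterm V}
      {xs e : List (Coterm V)} (hx : xs.length = σs.length) (h : Ev i u ((const .succ).app y))
      (h' : Ev j (t.apps (xs ++ y :: e)) w) :
      Ev (i + j + 1) ((const (.cond σs τ)).apps (s :: t :: (xs ++ u :: e))) w

theorem cond_apps_eq {σs : List Ty} {τ : Ty} {s t u : Coterm V}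
    {xs e : List (Coterm V)} :
    (const (.cond σs τ)).apps (s :: t :: (xs ++ u :: e)) =
      ((const (.cond σs τ)).apps (s :: t :: (xs ++ [u]))).apps e := by
  rw [← apps_append]; simp

namespace Ev

theorem head {i : ℕ} {t w : Coterm V} (h : Ev i t w) : ∃ r l, t = (const r).apps l := by
  cases h with
  | zero => exact ⟨_, [], rfl⟩
  | succ y => exact ⟨_, [y], rfl⟩
  | contr => exact ⟨_, _, rfl⟩
  | condZero => exact ⟨_, _, rfl⟩
  | condSucc => exact ⟨_, _, rfl⟩

theorem zero_inv {i : ℕ} {w : Coterm V} (h : Ev i (const .zero) w) : i = 0 ∧ w = const .zero := by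
  generalize ht : (const .zero : Coterm V) = t at h
  cases h with
  | zero => exact ⟨rfl, rfl⟩
  | succ y => exact (app_ne_const ht.symm).elim
  | contr e h _ => cases (const_apps_inj (l := []) ht).1; cases h
  | condZero => cases (const_apps_inj (l := []) ht).1
  | condSucc => cases (const_apps_inj (l := []) ht).1

theorem succ_inv {i : ℕ} {y w : Coterm V} (h : Ev i ((const .succ).app y) w) :
    i = 0 ∧ w = (const .succ).app y := by
  generalize ht : (const .succ : Coterm V).app y = t at h
  cases h with
  | zero => exact (app_ne_const ht).elim
  | succ y => exact ⟨rfl, rfl⟩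
  | contr e h _ => cases (const_apps_inj (l := [y]) ht).1; cases h
  | condZero => cases (const_apps_inj (l := [y]) ht).1
  | condSucc => cases (const_apps_inj (l := [y]) ht).1

theorem contr_inv {k : ℕ} {r : Rule} {l e : List (Coterm V)} {u w : Coterm V} (hc : Contr r l u)
    (h : Ev k ((const r).apps (l ++ e)) w) : ∃ i, k = i + 1 ∧ Ev i (u.apps e) w := by
  generalize ht : (const r).apps (l ++ e) = t at h
  cases h with
  | zero => cases (const_apps_inj (l' := []) ht).1; cases hc
  | succ y => cases (const_apps_inj (l' := [y]) ht).1; cases hc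
  | contr e' h h' =>
    obtain ⟨rfl, h2⟩ := const_apps_inj ht
    obtain ⟨rfl, rfl⟩ := List.append_inj h2 (hc.length_eq h)
    cases hc.unique h
    exact ⟨_, rfl, h'⟩
  | condZero => cases (const_apps_inj ht).1; cases hc
  | condSucc => cases (const_apps_inj ht).1; cases hc

theorem cond_inv {k : ℕ} {σs : List Ty} {τ : Ty} {xs e : List (Coterm V)} {s t u w : Coterm V}
    (hx : xs.length = σs.length)
    (h : Ev k ((const (.cond σs τ)).apps (s :: t :: (xs ++ u :: e))) w) :
    ∃ i j, k = i + j + 1 ∧ ((Ev i u (const .zero) ∧ Ev j (s.apps (xs ++ e)) w) ∨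
      ∃ y, Ev i u ((const .succ).app y) ∧ Ev j (t.apps (xs ++ y :: e)) w) := by
  generalize ht : (const (.cond σs τ)).apps (s :: t :: (xs ++ u :: e)) = v at h
  cases h with
  | zero => cases (const_apps_inj (l' := []) ht).1
  | succ y => cases (const_apps_inj (l' := [y]) ht).1
  | contr e h _ => cases (const_apps_inj ht).1; cases h
  | condZero τ t hx' h h' =>
    obtain ⟨h1, h2⟩ := const_apps_inj ht
    cases h1
    obtain ⟨rfl, h3⟩ := List.cons.inj h2
    obtain ⟨rfl, h4⟩ := List.cons.inj h3
    obtain ⟨rfl, h5⟩ := List.append_inj h4 (hx.trans hx'.symm)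
    obtain ⟨rfl, rfl⟩ := List.cons.inj h5
    exact ⟨_, _, rfl, .inl ⟨h, h'⟩⟩
  | condSucc τ s hx' h h' =>
    obtain ⟨h1, h2⟩ := const_apps_inj ht
    cases h1
    obtain ⟨rfl, h3⟩ := List.cons.inj h2
    obtain ⟨rfl, h4⟩ := List.cons.inj h3
    obtain ⟨rfl, h5⟩ := List.append_inj h4 (hx.trans hx'.symm)
    obtain ⟨rfl, rfl⟩ := List.cons.inj h5
    exact ⟨_, _, rfl, .inr ⟨_, h, h'⟩⟩

theorem unique {i j : ℕ} {t w w' : Coterm V} (h : Ev i t w) (h' : Ev j t w') : w = w' := by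
  induction h generalizing j w' with
  | zero => exact h'.zero_inv.2.symm
  | succ y => exact h'.succ_inv.2.symm
  | contr e hc _ ih =>
    obtain ⟨_, _, h⟩ := h'.contr_inv hc
    exact ih h
  | condZero τ t hx _ _ ih1 ih2 =>
    obtain ⟨_, _, _, ⟨h1, h2⟩ | ⟨y, h1, h2⟩⟩ := h'.cond_inv hx
    · exact ih2 h2
    · exact (app_ne_const (ih1 h1).symm).elim
  | condSucc τ t hx _ _ ih1 ih2 =>
    obtain ⟨_, _, _, ⟨h1, h2⟩ | ⟨y, h1, h2⟩⟩ := h'.cond_inv hx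
    · exact (app_ne_const (ih1 h1)).elim
    · obtain ⟨_, rfl⟩ := app_inj (ih1 h1)
      exact ih2 h2

theorem red {i : ℕ} {t w : Coterm V} (h : Ev i t w) : Relation.ReflTransGen Red t w := by
  have arg : ∀ {σs τ} {s t u u' : Coterm V} {xs e : List (Coterm V)},
      Relation.ReflTransGen Red u u' →
      Relation.ReflTransGen Red ((const (.cond σs τ)).apps (s :: t :: (xs ++ u :: e)))
        (((const (.cond σs τ)).apps (s :: t :: (xs ++ [u']))).apps e) := by
    intro σs τ s t u u' xs e h
    rw [cond_apps_eq]
    refine h.lift (fun u => ((const (.cond σs τ)).apps (s :: t :: (xs ++ [u]))).apps e) ?_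
    intro a b hab
    have := (hab.appRight ((const (.cond σs τ)).apps (s :: t :: xs))).apps e
    rwa [← apps_snoc, ← apps_snoc] at this
  induction h with
  | zero => exact .refl
  | succ y => exact .refl
  | contr e hc _ ih =>
    rw [apps_append]
    exact .head (hc.red.apps e) ih
  | condZero τ t hx _ _ ih1 ih2 =>
    rw [apps_append] at ih2
    exact (arg ih1).trans (.head ((Red.condZero _ τ _ t _ hx).apps _) ih2)
  | condSucc τ s hx _ _ ih1 ih2 =>
    rw [← List.singleton_append, ← List.append_assoc, apps_append] at ih2
    exact (arg ih1).trans (.head ((Red.condSucc _ τ s _ _ _ hx).apps _) ih2)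

end Ev

/-- Finite observations on terms of type `N`: no information, the value is `0`, or the value is a
successor together with an observation on the predecessor. -/
inductive Obsv : Type
  | bot
  | zero
  | succ (o : Obsv)

/-- `Obs o k t`: the observation `o` can be made on `t` with at most `k` contractions. -/
def Obs : Obsv → ℕ → Coterm V → Prop
  | .bot, _, _ => True
  | .zero, k, t => ∃ i ≤ k, Ev i t (const .zero)
  | .succ o, k, t => ∃ i j y, i + j ≤ k ∧ Ev i t ((const .succ).app y) ∧ Obs o j y

/-- The observation that the value is the number `n`. -/
def Obsv.num : ℕ → Obsv
  | 0 => .zero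
  | n + 1 => .succ (num n)

/-- `Val n t`: the term `t` evaluates to the number `n`. -/
def Val (n : ℕ) (t : Coterm V) : Prop := ∃ k, Obs (Obsv.num n) k t

namespace Obs

theorem mono {o : Obsv} {k k' : ℕ} {t : Coterm V} (h : Obs o k t) (hk : k ≤ k') : Obs o k' t := by
  cases o with
  | bot => trivial
  | zero => obtain ⟨i, hi, h⟩ := h; exact ⟨i, hi.trans hk, h⟩
  | succ o => obtain ⟨i, j, y, hi, h⟩ := h; exact ⟨i, j, y, hi.trans hk, h⟩

/-- If `t'` has every weak head value of `t`, after `d` further contractions, then it has every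
observation of `t`. -/
theorem transfer {o : Obsv} {k d : ℕ} {t t' : Coterm V}
    (H : ∀ i w, Ev i t w → Ev (i + d) t' w) (h : Obs o k t) : Obs o (k + d) t' := by
  cases o with
  | bot => trivial
  | zero => obtain ⟨i, hi, h⟩ := h; exact ⟨i + d, by omega, H _ _ h⟩
  | succ o => obtain ⟨i, j, y, hi, h, h'⟩ := h; exact ⟨i + d, j, y, by omega, H _ _ h, h'⟩

theorem contr {o : Obsv} {k : ℕ} {r : Rule} {l : List (Coterm V)} {u : Coterm V}
    (e : List (Coterm V)) (hc : Contr r l u) (h : Obs o k (u.apps e)) :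
    Obs o (k + 1) ((const r).apps (l ++ e)) :=
  transfer (fun _ _ h => h.contr e hc) h

theorem condZero {o : Obsv} {i j : ℕ} {σs : List Ty} (τ : Ty) {s : Coterm V} (t : Coterm V)
    {u : Coterm V} {xs e : List (Coterm V)} (hx : xs.length = σs.length)
    (h : Ev i u (const .zero)) (h' : Obs o j (s.apps (xs ++ e))) :
    Obs o (i + j + 1) ((const (.cond σs τ)).apps (s :: t :: (xs ++ u :: e))) := by
  refine (transfer (d := i + 1) (fun j w h' => ?_) h').mono (by omega)
  have := h.condZero τ t hx h'
  rwa [show i + j + 1 = j + (i + 1) by omega] at this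

theorem condSucc {o : Obsv} {i j : ℕ} {σs : List Ty} (τ : Ty) (s : Coterm V) {t u y : Coterm V}
    {xs e : List (Coterm V)} (hx : xs.length = σs.length)
    (h : Ev i u ((const .succ).app y)) (h' : Obs o j (t.apps (xs ++ y :: e))) :
    Obs o (i + j + 1) ((const (.cond σs τ)).apps (s :: t :: (xs ++ u :: e))) := by
  refine (transfer (d := i + 1) (fun j w h' => ?_) h').mono (by omega)
  have := h.condSucc τ s hx h'
  rwa [show i + j + 1 = j + (i + 1) by omega] at this

theorem contr_inv {o : Obsv} {k : ℕ} {r : Rule} {l e : List (Coterm V)} {u : Coterm V}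
    (hc : Contr r l u) (h : Obs o k ((const r).apps (l ++ e))) :
    o = .bot ∨ ∃ k', k = k' + 1 ∧ Obs o k' (u.apps e) := by
  cases o with
  | bot => exact .inl rfl
  | zero =>
    obtain ⟨i, hi, h⟩ := h
    obtain ⟨i, rfl, h2⟩ := h.contr_inv hc
    exact .inr ⟨k - 1, by omega, i, by omega, h2⟩
  | succ o =>
    obtain ⟨i, j, y, hi, h, h'⟩ := h
    obtain ⟨i, rfl, h2⟩ := h.contr_inv hc
    exact .inr ⟨k - 1, by omega, i, j, y, by omega, h2, h'⟩

theorem cond_inv {o : Obsv} {k : ℕ} {σs : List Ty} {τ : Ty} {xs e : List (Coterm V)}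
    {s t u : Coterm V} (hx : xs.length = σs.length)
    (h : Obs o k ((const (.cond σs τ)).apps (s :: t :: (xs ++ u :: e)))) :
    o = .bot ∨ ∃ i j, k = i + j + 1 ∧ ((Ev i u (const .zero) ∧ Obs o j (s.apps (xs ++ e))) ∨
      ∃ y, Ev i u ((const .succ).app y) ∧ Obs o j (t.apps (xs ++ y :: e))) := by
  cases o with
  | bot => exact .inl rfl
  | zero =>
    obtain ⟨i, hi, h⟩ := h
    obtain ⟨i, j, rfl, ⟨h1, h2⟩ | ⟨y, h1, h2⟩⟩ := h.cond_inv hx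
    · exact .inr ⟨i, k - i - 1, by omega, .inl ⟨h1, j, by omega, h2⟩⟩
    · exact .inr ⟨i, k - i - 1, by omega, .inr ⟨y, h1, j, by omega, h2⟩⟩
  | succ o =>
    obtain ⟨i, j, y', hi, h, h'⟩ := h
    obtain ⟨i, j, rfl, ⟨h1, h2⟩ | ⟨y, h1, h2⟩⟩ := h.cond_inv hx
    · exact .inr ⟨i, k - i - 1, by omega, .inl ⟨h1, j, _, y', by omega, h2, h'⟩⟩
    · exact .inr ⟨i, k - i - 1, by omega, .inr ⟨y, h1, j, _, y', by omega, h2, h'⟩⟩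

theorem head {o : Obsv} {k : ℕ} {t : Coterm V} (h : Obs o k t) :
    o = .bot ∨ ∃ r l, t = (const r).apps l := by
  cases o with
  | bot => exact .inl rfl
  | zero => obtain ⟨i, hi, h⟩ := h; exact .inr h.head
  | succ o => obtain ⟨i, j, y, hi, h, h'⟩ := h; exact .inr h.head

end Obs

theorem Val.unique {n m : ℕ} {t : Coterm V} (h : Val n t) (h' : Val m t) : n = m := by
  obtain ⟨k, h⟩ := h
  obtain ⟨k', h'⟩ := h'
  induction n generalizing m k k' t with
  | zero =>
    obtain ⟨i, _, h⟩ := h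
    cases m with
    | zero => rfl
    | succ m =>
      obtain ⟨_, _, y, _, h', _⟩ := h'
      exact (app_ne_const (h'.unique h)).elim
  | succ n ih =>
    obtain ⟨_, _, y, _, h, h1⟩ := h
    cases m with
    | zero =>
      obtain ⟨i, _, h'⟩ := h'
      exact (app_ne_const (h.unique h')).elim
    | succ m =>
      obtain ⟨_, _, y', _, h', h1'⟩ := h'
      obtain ⟨_, rfl⟩ := app_inj (h.unique h')
      rw [ih _ h1 _ h1']

theorem Val.zero : Val 0 (const .zero : Coterm V) := ⟨0, 0, le_rfl, .zero⟩

theorem val_succ_iff {n : ℕ} {y : Coterm V} : Val (n + 1) ((const .succ).app y) ↔ Val n y := by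
  constructor
  · rintro ⟨k, i, j, y', _, h, h'⟩
    obtain ⟨_, rfl⟩ := app_inj h.succ_inv.2
    exact ⟨j, h'⟩
  · rintro ⟨k, h⟩
    exact ⟨k, 0, k, y, by simp, .succ y, h⟩

theorem val_numeral (n : ℕ) : Val n (numeral V n).1 := by
  induction n with
  | zero => exact Val.zero
  | succ n ih => exact val_succ_iff.2 ih

theorem Val.red {n : ℕ} {t : Coterm V} (h : Val n t) :
    Relation.ReflTransGen Red t (numeral V n).1 := by
  obtain ⟨k, h⟩ := h
  induction n generalizing k t with
  | zero => obtain ⟨_, _, h⟩ := h; exact h.red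
  | succ n ih =>
    obtain ⟨_, _, y, _, h, h'⟩ := h
    exact h.red.trans ((ih _ h').lift _ fun _ _ h => h.appRight _)

/-! ### A step-indexed logical relation -/

/-- `Rel σ k t t'`: at type `σ`, the term `t'` lies above `t` as far as computations of at most `k`
contractions can tell. At type `N`, every observation on `t` within `k` contractions can also be made
on `t'`, where the number of contractions is not bounded; at an arrow type, related arguments are
mapped to related results, for all indices up to `k`. -/
def Rel : Ty → ℕ → Coterm V → Coterm V → Prop
  | .N, k, t, t' => ∀ o, Obs o k t → ∃ k', Obs o k' t'
  | .arr σ τ, k, t, t' => ∀ j ≤ k, ∀ s s', Rel σ j s s' → Rel τ j (t.app s) (t'.app s')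

/-- Lists of related terms of given types. -/
inductive Forall₃ (R : Ty → Coterm V → Coterm V → Prop) :
    List Ty → List (Coterm V) → List (Coterm V) → Prop
  | nil : Forall₃ R [] [] []
  | cons {σ : Ty} {Γ : List Ty} {x x' : Coterm V} {xs xs' : List (Coterm V)} (h : R σ x x')
      (hs : Forall₃ R Γ xs xs') : Forall₃ R (σ :: Γ) (x :: xs) (x' :: xs')

namespace Forall₃

variable {R S : Ty → Coterm V → Coterm V → Prop}

theorem imp (H : ∀ σ x x', R σ x x' → S σ x x') {Γ : List Ty} {xs xs' : List (Coterm V)}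
    (h : Forall₃ R Γ xs xs') : Forall₃ S Γ xs xs' := by
  induction h with
  | nil => exact .nil
  | cons h _ ih => exact .cons (H _ _ _ h) ih

theorem append {Γ Δ : List Ty} {xs xs' ys ys' : List (Coterm V)} (h : Forall₃ R Γ xs xs')
    (h' : Forall₃ R Δ ys ys') : Forall₃ R (Γ ++ Δ) (xs ++ ys) (xs' ++ ys') := by
  induction h with
  | nil => exact h'
  | cons h _ ih => exact .cons h ih

theorem append_inv {Γ Δ : List Ty} {zs zs' : List (Coterm V)} (h : Forall₃ R (Γ ++ Δ) zs zs') :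
    ∃ xs ys xs' ys', zs = xs ++ ys ∧ zs' = xs' ++ ys' ∧ Forall₃ R Γ xs xs' ∧
      Forall₃ R Δ ys ys' := by
  induction Γ generalizing zs zs' with
  | nil => exact ⟨[], zs, [], zs', rfl, rfl, .nil, h⟩
  | cons σ Γ ih =>
    cases h with
    | cons h1 h2 =>
      obtain ⟨xs, ys, xs', ys', rfl, rfl, h3, h4⟩ := ih h2
      exact ⟨_ :: xs, ys, _ :: xs', ys', rfl, rfl, .cons h1 h3, h4⟩

theorem length_left {Γ : List Ty} {xs xs' : List (Coterm V)} (h : Forall₃ R Γ xs xs') :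
    xs.length = Γ.length := by
  induction h with
  | nil => rfl
  | cons _ _ ih => simp [ih]

theorem length_right {Γ : List Ty} {xs xs' : List (Coterm V)} (h : Forall₃ R Γ xs xs') :
    xs'.length = Γ.length := by
  induction h with
  | nil => rfl
  | cons _ _ ih => simp [ih]

theorem of_forall₂ {Γ : List Ty} {xs : List (Coterm V)}
    (h : List.Forall₂ (fun σ x => R σ x x) Γ xs) : Forall₃ R Γ xs xs := by
  induction h with
  | nil => exact .nil
  | cons h _ ih => exact .cons h ih

end Forall₃

namespace Rel

theorem mono {σ : Ty} {k j : ℕ} {t t' : Coterm V} (h : Rel σ k t t') (hj : j ≤ k) :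
    Rel σ j t t' := by
  cases σ with
  | N => exact fun o ho => h o (ho.mono hj)
  | arr σ τ => exact fun i hi => h i (hi.trans hj)

theorem apps {Γ : List Ty} {τ : Ty} {k : ℕ} {t t' : Coterm V} {xs xs' : List (Coterm V)}
    (h : Rel (arrows Γ τ) k t t') (hx : Forall₃ (fun σ => Rel σ k) Γ xs xs') :
    Rel τ k (t.apps xs) (t'.apps xs') := by
  induction hx generalizing t t' with
  | nil => exact h
  | cons hx _ ih => exact ih (h k le_rfl _ _ hx)

theorem of_forall_apps {Γ : List Ty} {τ : Ty} {k : ℕ} {t t' : Coterm V}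
    (h : ∀ j ≤ k, ∀ xs xs', Forall₃ (fun σ => Rel σ j) Γ xs xs' →
      Rel τ j (t.apps xs) (t'.apps xs')) : Rel (arrows Γ τ) k t t' := by
  induction Γ generalizing k t t' with
  | nil => exact h k le_rfl [] [] .nil
  | cons σ Γ ih =>
    intro j hj s s' hs
    exact ih fun i hi xs xs' hx => h i (hi.trans hj) _ _ (.cons (hs.mono hi) hx)

/-- Relatedness at any type is a matter of the nontrivial observations that can be made after
application to enough related arguments to reach type `N`. -/
theorem of_forall_obs {τ : Ty} {k : ℕ} {t t' : Coterm V}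
    (h : ∀ j ≤ k, ∀ Γ xs xs', τ = arrows Γ .N → Forall₃ (fun σ => Rel σ j) Γ xs xs' →
      ∀ o, o ≠ .bot → Obs o j (t.apps xs) → ∃ k', Obs o k' (t'.apps xs')) : Rel τ k t t' := by
  obtain ⟨Γ, rfl⟩ := exists_eq_arrows τ
  refine of_forall_apps fun j hj xs xs' hx o ho => ?_
  by_cases hb : o = .bot
  · subst hb; exact ⟨0, trivial⟩
  · exact h j hj Γ xs xs' rfl hx o hb ho

theorem contr {τ : Ty} {k : ℕ} {r : Rule} {l l' : List (Coterm V)} {u u' : Coterm V}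
    (hl : Contr r l u) (hl' : Contr r l' u') (h : ∀ j < k, Rel τ j u u') :
    Rel τ k ((const r).apps l) ((const r).apps l') := by
  refine of_forall_obs fun j hj Γ xs xs' hτ hx o hb ho => ?_
  subst hτ
  rw [← apps_append] at ho ⊢
  obtain hb' | ⟨i, rfl, ho'⟩ := ho.contr_inv hl
  · exact (hb hb').elim
  · obtain ⟨k', h'⟩ := ((h i hj).apps (hx.imp fun _ _ _ h => h.mono (by omega))) o ho'
    exact ⟨_, h'.contr _ hl'⟩

/-- On the side of `u'` the evaluation that shows a successor is unique, so that all observations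
on the predecessor `y` transfer to one and the same predecessor `y'`. -/
theorem exists_pred {k i : ℕ} {u u' y : Coterm V} (h : Rel .N k u u') (hi : i ≤ k)
    (hy : Ev i u ((const .succ).app y)) :
    ∃ i' y', Ev i' u' ((const .succ).app y') ∧ Rel .N (k - i) y y' := by
  obtain ⟨k', i', j', y', _, h1, _⟩ := h (.succ .bot) ⟨i, 0, y, by omega, hy, trivial⟩
  refine ⟨i', y', h1, fun o ho => ?_⟩
  obtain ⟨k', i'', j'', y'', _, h2, h3⟩ := h (.succ o) ⟨i, k - i, y, by omega, hy, ho⟩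
  obtain ⟨_, rfl⟩ := app_inj (h1.unique h2)
  exact ⟨_, h3⟩

theorem cond {σs : List Ty} {τ : Ty} {k : ℕ} {s s' t t' u u' : Coterm V}
    {xs xs' : List (Coterm V)} (hs : ∀ j < k, Rel (arrows σs τ) j s s')
    (ht : ∀ j < k, Rel (arrows (σs ++ [.N]) τ) j t t') (hx : Forall₃ (fun σ => Rel σ k) σs xs xs')
    (hu : Rel .N k u u') :
    Rel τ k ((const (.cond σs τ)).apps (s :: t :: (xs ++ [u])))
      ((const (.cond σs τ)).apps (s' :: t' :: (xs' ++ [u']))) := by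
  refine of_forall_obs fun K hK Γ e e' hτ he o hb ho => ?_
  subst hτ
  rw [← cond_apps_eq] at ho ⊢
  obtain hb' | ⟨i, j, rfl, ⟨h1, h2⟩ | ⟨y, h1, h2⟩⟩ := ho.cond_inv hx.length_left
  · exact (hb hb').elim
  · obtain ⟨_, i', _, h1'⟩ := hu .zero ⟨i, by omega, h1⟩
    rw [apps_append] at h2
    obtain ⟨k', h2'⟩ := (((hs j (by omega)).apps (hx.imp fun _ _ _ h => h.mono (by omega))).apps
      (he.imp fun _ _ _ h => h.mono (by omega))) o h2
    rw [← apps_append] at h2'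
    exact ⟨_, h2'.condZero _ _ hx.length_right h1'⟩
  · obtain ⟨i', y', h1', hy⟩ := hu.exists_pred (by omega) h1
    rw [← List.singleton_append, ← List.append_assoc, apps_append] at h2
    obtain ⟨k', h2'⟩ := (((ht j (by omega)).apps ((hx.imp fun _ _ _ h => h.mono (by omega)).append
      (.cons (hy.mono (by omega)) .nil))).apps (he.imp fun _ _ _ h => h.mono (by omega))) o h2
    rw [← apps_append, List.append_assoc, List.singleton_append] at h2'
    exact ⟨_, h2'.condSucc _ _ hx.length_right h1'⟩

/-- A step maps related premisses and arguments to related results. Since it takes a contraction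
for a step to use its premisses, these need be related only at smaller indices. -/
theorem rule (r : Rule) {k : ℕ} {ps ps' xs xs' : List (Coterm V)}
    (hp : Forall₃ (fun σ t t' => ∀ j < k, Rel σ j t t') (r.premises.map Sequent.toTy) ps ps')
    (hz : Forall₃ (fun σ => Rel σ k) r.conclusion.ctx xs xs') :
    Rel r.conclusion.goal k ((const r).apps (ps ++ xs)) ((const r).apps (ps' ++ xs')) := by
  have lt : ∀ {Γ xs xs'}, Forall₃ (fun σ => Rel σ k) Γ xs xs' → ∀ j < k,
      Forall₃ (V := V) (fun σ => Rel σ j) Γ xs xs' :=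
    fun h j hj => h.imp fun _ _ _ h => h.mono hj.le
  cases r with
  | id σ =>
    rcases hp with _ | _
    rcases hz with _ | ⟨hx, _ | _⟩
    exact contr (.id _ _) (.id _ _) fun j hj => hx.mono hj.le
  | ex ρs ρ σ σs τ =>
    rcases hp with _ | ⟨ht, _ | _⟩
    obtain ⟨xs, ys, xs', ys', rfl, rfl, hx, hy⟩ := hz.append_inv
    rcases hy with _ | ⟨ha, _ | ⟨hb, hy⟩⟩
    exact contr (.ex _ _ _ _ _ _ _ _ _ _ hx.length_left hy.length_left)
      (.ex _ _ _ _ _ _ _ _ _ _ hx.length_right hy.length_right) fun j hj =>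
      (ht j hj).apps ((lt hx j hj).append (.cons (hb.mono hj.le) (.cons (ha.mono hj.le)
        (lt hy j hj))))
  | wk σs σ τ =>
    rcases hp with _ | ⟨ht, _ | _⟩
    obtain ⟨xs, ys, xs', ys', rfl, rfl, hx, hy⟩ := hz.append_inv
    rcases hy with _ | ⟨ha, _ | _⟩
    exact contr (.wk _ _ _ _ _ _ hx.length_left) (.wk _ _ _ _ _ _ hx.length_right) fun j hj =>
      (ht j hj).apps (lt hx j hj)
  | cntr σs σ τ =>
    rcases hp with _ | ⟨ht, _ | _⟩
    obtain ⟨xs, ys, xs', ys', rfl, rfl, hx, hy⟩ := hz.append_inv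
    rcases hy with _ | ⟨ha, _ | _⟩
    exact contr (.cntr _ _ _ _ _ _ hx.length_left) (.cntr _ _ _ _ _ _ hx.length_right) fun j hj =>
      (ht j hj).apps ((lt hx j hj).append (.cons (ha.mono hj.le) (.cons (ha.mono hj.le) .nil)))
  | cut σs σ τ =>
    rcases hp with _ | ⟨hs, _ | ⟨ht, _ | _⟩⟩
    exact contr (.cut _ _ _ _ _ _ hz.length_left) (.cut _ _ _ _ _ _ hz.length_right) fun j hj =>
      (ht j hj).apps ((lt hz j hj).append (.cons ((hs j hj).apps (lt hz j hj)) .nil))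
  | L σs ρ σ τ =>
    rcases hp with _ | ⟨hs, _ | ⟨ht, _ | _⟩⟩
    obtain ⟨xs, ys, xs', ys', rfl, rfl, hx, hy⟩ := hz.append_inv
    rcases hy with _ | ⟨ha, _ | _⟩
    exact contr (.L _ _ _ _ _ _ _ _ hx.length_left) (.L _ _ _ _ _ _ _ _ hx.length_right)
      fun j hj => (ht j hj).apps ((lt hx j hj).append
        (.cons (ha j hj.le _ _ ((hs j hj).apps (lt hx j hj))) .nil))
  | R σs σ τ =>
    rcases hp with _ | ⟨ht, _ | _⟩
    intro i hi a a' ha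
    rw [← apps_snoc, ← apps_snoc]
    exact contr (.R _ _ _ _ _ _ hz.length_left) (.R _ _ _ _ _ _ hz.length_right) fun j hj =>
      (ht j (by omega)).apps ((lt hz j (by omega)).append (.cons (ha.mono hj.le) .nil))
  | zero =>
    rcases hp with _ | _
    rcases hz with _ | _
    exact fun o ho => ⟨_, ho⟩
  | succ =>
    rcases hp with _ | _
    rcases hz with _ | ⟨hx, _ | _⟩
    intro o ho
    cases o with
    | bot => exact ⟨0, trivial⟩
    | zero =>
      obtain ⟨_, _, h⟩ := ho
      exact (app_ne_const h.succ_inv.2.symm).elim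
    | succ o =>
      obtain ⟨i, j, y, hij, h, h'⟩ := ho
      obtain ⟨_, rfl⟩ := app_inj h.succ_inv.2
      obtain ⟨k', h'⟩ := hx o (h'.mono (by omega))
      exact ⟨k', 0, k', _, by omega, .succ _, h'⟩
  | cond σs τ =>
    rcases hp with _ | ⟨hs, _ | ⟨ht, _ | _⟩⟩
    obtain ⟨xs, ys, xs', ys', rfl, rfl, hx, hy⟩ := hz.append_inv
    rcases hy with _ | ⟨hu, _ | _⟩
    exact cond hs ht hx hu

end Rel

/-- The fundamental theorem of the logical relation. No progress condition is needed: unfolding a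
coderivation takes a contraction, so that the index decreases. -/
theorem IsFarc.rel {σ : Ty} {t : Coterm V} (h : IsFarc σ t) (k : ℕ) : Rel σ k t t := by
  induction k using Nat.strong_induction_on generalizing σ t with
  | _ k ihk =>
    induction h with
    | @var σ v =>
      refine Rel.of_forall_obs fun j hj Γ xs xs' hτ hx o hb ho => ?_
      obtain hb' | ⟨r, l, h⟩ := ho.head
      · exact (hb hb').elim
      · exact (var_apps_ne h).elim
    | const r =>
      rw [Rule.toTy_eq]
      refine Rel.of_forall_apps fun j hj zs zs' hz => ?_
      obtain ⟨xs, ys, xs', ys', rfl, rfl, hx, hy⟩ := hz.append_inv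
      exact Rel.rule r (hx.imp fun _ _ _ h i hi => h.mono hi.le) hy
    | coder d hd hr =>
      refine Rel.of_forall_apps fun j hj xs xs' hx => ?_
      rw [RuleTree.toCoterm_eq_apps, ← apps_append, ← apps_append]
      refine Rel.rule d.rule (Forall₃.of_forall₂ ?_) hx
      exact RuleTree.children_forall₂ (fun σ t => ∀ i < j, Rel σ i t t) hd fun i n hn =>
        ihk n (by omega) (.coder _ (hd.child i) (hr.child i))
    | app ht hs iht ihs => exact iht k le_rfl _ _ ihs

/-! ### Conversion preserves observations -/

/-- `t` behaves like its head reduct `t'`: however they are applied, they have the same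
observations, which on the side of `t'` take no more contractions. -/
structure HeadRed (t t' : Coterm V) : Prop where
  fwd : ∀ e o k, Obs o k (t.apps e) → Obs o k (t'.apps e)
  bwd : ∀ e o k, Obs o k (t'.apps e) → ∃ k', Obs o k' (t.apps e)

namespace HeadRed

theorem refl (t : Coterm V) : HeadRed t t := ⟨fun _ _ _ h => h, fun _ _ k h => ⟨k, h⟩⟩

theorem trans {t t' t'' : Coterm V} (h : HeadRed t t') (h' : HeadRed t' t'') : HeadRed t t'' :=
  ⟨fun e o k ho => h'.fwd e o k (h.fwd e o k ho), fun e o k ho => by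
    obtain ⟨k', ho'⟩ := h'.bwd e o k ho
    exact h.bwd e o k' ho'⟩

theorem apps {t t' : Coterm V} (h : HeadRed t t') (l : List (Coterm V)) :
    HeadRed (t.apps l) (t'.apps l) := by
  constructor <;> intro e o k ho <;> rw [← apps_append] at ho ⊢
  · exact h.fwd _ _ _ ho
  · exact h.bwd _ _ _ ho

theorem obs {t t' : Coterm V} (h : HeadRed t t') {o : Obsv} {k : ℕ} (ho : Obs o k t) : Obs o k t' :=
  h.fwd [] o k ho

theorem exists_obs {t t' : Coterm V} (h : HeadRed t t') {o : Obsv} {k : ℕ} (ho : Obs o k t') :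
    ∃ k', Obs o k' t :=
  h.bwd [] o k ho

theorem condZero {i : ℕ} {σs : List Ty} (τ : Ty) (s t : Coterm V) {u : Coterm V}
    {xs : List (Coterm V)} (hx : xs.length = σs.length) (hu : Ev i u (const .zero)) :
    HeadRed ((const (.cond σs τ)).apps (s :: t :: (xs ++ [u]))) (s.apps xs) := by
  constructor <;> intro e o k ho
  · rw [← cond_apps_eq] at ho
    rw [← apps_append]
    obtain rfl | ⟨i, j, rfl, ⟨h1, h2⟩ | ⟨y, h1, h2⟩⟩ := ho.cond_inv hx
    · trivial
    · exact h2.mono (by omega)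
    · exact (app_ne_const (h1.unique hu)).elim
  · rw [← cond_apps_eq]
    rw [← apps_append] at ho
    exact ⟨_, ho.condZero _ _ hx hu⟩

theorem condSucc {i : ℕ} {σs : List Ty} (τ : Ty) (s t : Coterm V) {u y : Coterm V}
    {xs : List (Coterm V)} (hx : xs.length = σs.length) (hu : Ev i u ((const .succ).app y)) :
    HeadRed ((const (.cond σs τ)).apps (s :: t :: (xs ++ [u]))) (t.apps (xs ++ [y])) := by
  constructor <;> intro e o k ho
  · rw [← cond_apps_eq] at ho
    rw [← apps_append, List.append_assoc, List.singleton_append]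
    obtain rfl | ⟨i, j, rfl, ⟨h1, h2⟩ | ⟨y, h1, h2⟩⟩ := ho.cond_inv hx
    · trivial
    · exact (app_ne_const (hu.unique h1)).elim
    · obtain ⟨_, rfl⟩ := app_inj (h1.unique hu)
      exact h2.mono (by omega)
  · rw [← cond_apps_eq]
    rw [← apps_append, List.append_assoc, List.singleton_append] at ho
    exact ⟨_, ho.condSucc _ _ hx hu⟩

end HeadRed

theorem Contr.headRed {r : Rule} {l : List (Coterm V)} {u : Coterm V} (h : Contr r l u) :
    HeadRed ((const r).apps l) u := by
  constructor <;> intro e o k ho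
  · rw [← apps_append] at ho
    obtain rfl | ⟨k', rfl, ho'⟩ := ho.contr_inv h
    · trivial
    · exact ho'.mono (by omega)
  · rw [← apps_append]
    exact ⟨_, ho.contr e h⟩

/-- Since `t'` is related to itself, so are `t` and `t'`, which have the same observations. -/
theorem HeadRed.rel {τ : Ty} {t t' : Coterm V} (H : HeadRed t t') (h : IsFarc τ t') (k : ℕ) :
    Rel τ k t t' ∧ Rel τ k t' t := by
  constructor
  · refine Rel.of_forall_obs fun j hj Γ xs xs' hτ hx o hb ho => ?_
    subst hτ
    exact ((h.rel j).apps hx) o (H.fwd _ _ _ ho)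
  · refine Rel.of_forall_obs fun j hj Γ xs xs' hτ hx o hb ho => ?_
    subst hτ
    obtain ⟨j', ho⟩ := ((h.rel j).apps hx) o ho
    exact H.bwd _ _ _ ho

/-- Both sides of a reduction are related in both directions: contexts preserve this by the
fundamental theorem. -/
theorem Red.rel {t t' : Coterm V} (h : Red t t') : ∀ {τ : Ty}, IsFarc τ t → ∀ k,
    Rel τ k t t' ∧ Rel τ k t' t := by
  refine Red.induct (P := fun t t' => ∀ {τ : Ty}, IsFarc τ t → ∀ k,
    Rel τ k t t' ∧ Rel τ k t' t) ?_ ?_ ?_ ?_ ?_ t t' h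
  · exact fun r l u hc τ ht => hc.headRed.rel (hc.isFarc ht)
  · exact fun σs τ s t xs hx τ ht =>
      (HeadRed.condZero _ s t hx .zero).rel ((Red.condZero _ _ _ _ _ hx).isFarc ht)
  · exact fun σs τ s t y xs hx τ ht =>
      (HeadRed.condSucc _ s t hx (.succ y)).rel ((Red.condSucc _ _ _ _ _ _ hx).isFarc ht)
  · intro t t' s h ih τ ht k
    obtain ⟨σ, h1, h2⟩ := ht.app_inv
    exact ⟨(ih h1 k).1 k le_rfl _ _ (h2.rel k), (ih h1 k).2 k le_rfl _ _ (h2.rel k)⟩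
  · intro t s s' h ih τ ht k
    obtain ⟨σ, h1, h2⟩ := ht.app_inv
    exact ⟨h1.rel k k le_rfl _ _ (ih h2 k).1, h1.rel k k le_rfl _ _ (ih h2 k).2⟩

theorem Val.of_rel {n : ℕ} {t t' : Coterm V} (h : Val n t) (H : ∀ k, Rel .N k t t') : Val n t' := by
  obtain ⟨k, h⟩ := h
  exact H k _ h

theorem Conv.val_iff {t t' : Farc V .N} (h : Conv t t') (n : ℕ) : Val n t.1 ↔ Val n t'.1 := by
  induction h with
  | rel t t' h =>
    exact ⟨fun h' => h'.of_rel fun k => (h.rel t.2 k).1, fun h' => h'.of_rel fun k => (h.rel t.2 k).2⟩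
  | refl => rfl
  | symm _ _ _ ih => exact ih.symm
  | trans _ _ _ _ _ ih1 ih2 => exact ih1.trans ih2

theorem Conv.refl {σ : Ty} (t : Farc V σ) : Conv t t := Relation.EqvGen.refl t

theorem Conv.symm {σ : Ty} {t t' : Farc V σ} (h : Conv t t') : Conv t' t := Relation.EqvGen.symm _ _ h

theorem Conv.trans {σ : Ty} {t t' t'' : Farc V σ} (h : Conv t t') (h' : Conv t' t'') :
    Conv t t'' := Relation.EqvGen.trans _ _ _ h h'

theorem Conv.app {σ τ : Ty} {t t' : Farc V (.arr σ τ)} {s s' : Farc V σ} (ht : Conv t t')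
    (hs : Conv s s') : Conv (t.app s) (t'.app s') := by
  have h1 : Conv (t.app s) (t'.app s) := by
    induction ht with
    | rel t t' h => exact .rel _ _ (h.appLeft _)
    | refl => exact .refl _
    | symm _ _ _ ih => exact ih.symm
    | trans _ _ _ _ _ ih1 ih2 => exact ih1.trans ih2
  refine h1.trans ?_
  clear h1 ht
  induction hs with
  | rel t t' h => exact .rel _ _ (h.appRight _)
  | refl => exact .refl _
  | symm _ _ _ ih => exact ih.symm
  | trans _ _ _ _ _ ih1 ih2 => exact ih1.trans ih2

theorem Conv.of_red {σ : Ty} {t t' : Farc V σ} (h : Relation.ReflTransGen Red t.1 t'.1) :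
    Conv t t' := by
  obtain ⟨t, ht⟩ := t
  obtain ⟨t', ht'⟩ := t'
  dsimp only at h
  induction h using Relation.ReflTransGen.head_induction_on with
  | refl => exact .refl _
  | head h _ ih => exact Conv.trans (t' := ⟨_, h.isFarc ht⟩) (.rel _ _ h) (ih _)

/-- A farc converts to the numeral of `n` if and only if it evaluates to `n`. -/
theorem conv_numeral_iff {t : Farc V .N} {n : ℕ} : Conv t (numeral V n) ↔ Val n t.1 :=
  ⟨fun h => (h.val_iff n).2 (val_numeral n), fun h => .of_red h.red⟩

/-! ### Hereditary totality -/

/-- Hereditarily total coterms: the description of `HRset` in terms of evaluation. -/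
def Tot : Ty → Coterm V → Prop
  | .N, t => IsFarc .N t ∧ ∃ n, Val n t
  | .arr σ τ, t => IsFarc (.arr σ τ) t ∧ ∀ s, Tot σ s → Tot τ (t.app s)

theorem Tot.isFarc {σ : Ty} {t : Coterm V} (h : Tot σ t) : IsFarc σ t := by
  cases σ with
  | N => exact h.1
  | arr σ τ => exact h.1

theorem mem_HRset_iff {σ : Ty} {t : Farc V σ} : t ∈ HRset V σ ↔ Tot σ t.1 := by
  induction σ with
  | N =>
    change (∃ n, Conv t (numeral V n)) ↔ (IsFarc .N t.1 ∧ ∃ n, Val n t.1)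
    simp only [conv_numeral_iff, t.2, true_and]
  | arr σ τ ihσ ihτ =>
    change (∀ s, s ∈ HRset V σ → t.app s ∈ HRset V τ) ↔
      (IsFarc (.arr σ τ) t.1 ∧ ∀ s, Tot σ s → Tot τ (t.1.app s))
    refine ⟨fun h => ⟨t.2, fun s hs => ?_⟩, fun h s hs => ?_⟩
    · exact ihτ.1 (h ⟨s, hs.isFarc⟩ (ihσ.2 hs))
    · exact ihτ.2 (h.2 _ (ihσ.1 hs))

theorem isFarc_of_forall₂_tot {Γ : List Ty} {xs : List (Coterm V)} (h : List.Forall₂ Tot Γ xs) :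
    List.Forall₂ IsFarc Γ xs := h.imp fun _ _ h => h.isFarc

theorem Tot.apps {Γ : List Ty} {τ : Ty} {t : Coterm V} {xs : List (Coterm V)}
    (h : Tot (arrows Γ τ) t) (hx : List.Forall₂ Tot Γ xs) : Tot τ (t.apps xs) := by
  induction hx generalizing t with
  | nil => exact h
  | cons hx _ ih => exact ih (h.2 _ hx)

theorem Tot.of_forall_apps {Γ : List Ty} {τ : Ty} {t : Coterm V} (ht : IsFarc (arrows Γ τ) t)
    (h : ∀ xs, List.Forall₂ Tot Γ xs → Tot τ (t.apps xs)) : Tot (arrows Γ τ) t := by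
  induction Γ generalizing t with
  | nil => exact h [] .nil
  | cons σ Γ ih =>
    exact ⟨ht, fun s hs => ih (.app ht hs.isFarc) fun xs hx => h _ (.cons hs hx)⟩

theorem Tot.of_headRed {τ : Ty} {t t' : Coterm V} (H : HeadRed t t') (ht : IsFarc τ t)
    (h : Tot τ t') : Tot τ t := by
  induction τ generalizing t t' with
  | N =>
    obtain ⟨_, n, k, h⟩ := h
    exact ⟨ht, n, H.exists_obs h⟩
  | arr σ τ _ ih =>
    exact ⟨ht, fun s hs => ih (H.apps [s]) (.app ht hs.isFarc) (h.2 s hs)⟩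

theorem isFarc_of_reflTransGen {τ : Ty} {t t' : Coterm V} (h : Relation.ReflTransGen Red t t')
    (ht : IsFarc τ t) : IsFarc τ t' := by
  induction h with
  | refl => exact ht
  | tail _ h ih => exact h.isFarc ih

/-- A total term of type `N` with value `n + 1` evaluates to the successor of a total term with
value `n`. -/
theorem exists_ev_succ {n : ℕ} {u : Coterm V} (hu : IsFarc .N u) (h : Val (n + 1) u) :
    ∃ i y, Ev i u ((const .succ).app y) ∧ IsFarc .N y ∧ Val n y := by
  obtain ⟨_, i, j, y, _, h1, h2⟩ := h
  obtain ⟨σ, h3, h4⟩ := (isFarc_of_reflTransGen h1.red hu).app_inv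
  cases h3.const_inv
  exact ⟨i, y, h1, h4, j, h2⟩

/-- How the values of the arguments of type `N` behave along immediate ancestry: they do not grow
from the conclusion to premiss number `i`, and the principal one of a `cond` step becomes smaller. -/
def ValDescends (r : Rule) (i : ℕ) (xs ys : List (Coterm V)) : Prop :=
  ∀ a b, r.Ancestor i a b → ∀ x, xs[b]? = some x → ∃ y, ys[a]? = some y ∧
    ∀ n, Val n x → ∃ m ≤ n, Val m y ∧ (r.CondPrincipal b → m < n)

theorem valDescends_of_eq {r : Rule} {i : ℕ} {xs ys : List (Coterm V)}
    (hr : ∀ b, ¬ r.CondPrincipal b) (h : ∀ a b, r.Ancestor i a b → ys[a]? = xs[b]?) :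
    ValDescends r i xs ys :=
  fun a b hab x hx => ⟨x, (h a b hab).trans hx, fun n hn => ⟨n, le_rfl, hn, fun h => (hr b h).elim⟩⟩

/-- If a step applied to premisses and hereditarily total arguments is not hereditarily total, then
one of its premisses has the same defect, for arguments whose values descend along ancestry. -/
theorem exists_premise_not_tot (r : Rule) {ps xs : List (Coterm V)}
    (hp : List.Forall₂ IsFarc (r.premises.map Sequent.toTy) ps)
    (hz : List.Forall₂ Tot r.conclusion.ctx xs)
    (h : ¬ Tot r.conclusion.goal ((const r).apps (ps ++ xs))) :
    ∃ (i : ℕ) (S : Sequent) (p : Coterm V) (ys : List (Coterm V)), r.premises[i]? = some S ∧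
      ps[i]? = some p ∧ List.Forall₂ Tot S.ctx ys ∧ ¬ Tot S.goal (p.apps ys) ∧
      ValDescends r i xs ys := by
  have hf : IsFarc r.conclusion.goal ((const r).apps (ps ++ xs)) :=
    IsFarc.apps (Rule.toTy_eq r ▸ IsFarc.const r) (forall₂_append hp (isFarc_of_forall₂_tot hz))
  cases r with
  | id σ =>
    rcases hp with _ | _
    rcases hz with _ | ⟨hx, _ | _⟩
    exact (h (.of_headRed (Contr.headRed (.id _ _)) hf hx)).elim
  | ex ρs ρ σ σs τ =>
    rcases hp with _ | ⟨ht, _ | _⟩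
    obtain ⟨xs, ys, rfl, hx, hy⟩ := forall₂_append_inv hz
    rcases hy with _ | ⟨ha, _ | ⟨hb, hy⟩⟩
    refine ⟨0, _, _, _, rfl, rfl, forall₂_append hx (.cons hb (.cons ha hy)), fun hu =>
      h (.of_headRed (Contr.headRed (.ex _ _ _ _ _ _ _ _ _ _ hx.length_eq.symm hy.length_eq.symm)) hf hu),
      valDescends_of_eq (by simp [Rule.CondPrincipal]) fun a b hab => ?_⟩
    have hl := hx.length_eq
    rcases hab with ⟨rfl, h1⟩ | ⟨rfl, rfl⟩ | ⟨rfl, rfl⟩ | ⟨rfl, h1, h2⟩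
    · rw [List.getElem?_append_left (by omega), List.getElem?_append_left (by omega)]
    · rw [hl, List.getElem?_append_right (by omega), List.getElem?_append_right (by omega)]
      simp
    · rw [hl, List.getElem?_append_right (by omega), List.getElem?_append_right (by omega)]
      simp
    · rw [List.getElem?_append_right (by omega), List.getElem?_append_right (by omega)]
      -- Past the two exchanged arguments, the lists of arguments agree.
      obtain ⟨c, hc⟩ : ∃ c, a - xs.length = c + 2 := ⟨a - xs.length - 2, by omega⟩
      rw [hc]
      rfl
  | wk σs σ τ =>
    rcases hp with _ | ⟨ht, _ | _⟩
    obtain ⟨xs, ys, rfl, hx, hy⟩ := forall₂_append_inv hz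
    rcases hy with _ | ⟨ha, _ | _⟩
    refine ⟨0, _, _, _, rfl, rfl, hx, fun hu =>
      h (.of_headRed (Contr.headRed (.wk _ _ _ _ _ _ hx.length_eq.symm)) hf hu),
      valDescends_of_eq (by simp [Rule.CondPrincipal]) fun a b hab => ?_⟩
    have hl := hx.length_eq
    obtain ⟨rfl, h1⟩ := hab
    rw [List.getElem?_append_left (by omega)]
  | cntr σs σ τ =>
    rcases hp with _ | ⟨ht, _ | _⟩
    obtain ⟨xs, ys, rfl, hx, hy⟩ := forall₂_append_inv hz
    rcases hy with _ | ⟨ha, _ | _⟩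
    refine ⟨0, _, _, _, rfl, rfl, forall₂_append hx (.cons ha (.cons ha .nil)), fun hu =>
      h (.of_headRed (Contr.headRed (.cntr _ _ _ _ _ _ hx.length_eq.symm)) hf hu),
      valDescends_of_eq (by simp [Rule.CondPrincipal]) fun a b hab => ?_⟩
    have hl := hx.length_eq
    rcases hab with ⟨rfl, h1⟩ | ⟨rfl, rfl | rfl⟩
    · rw [List.getElem?_append_left (by omega), List.getElem?_append_left (by omega)]
    · simp [hl]
    · simp [hl]
  | cut σs σ τ =>
    rcases hp with _ | ⟨hs, _ | ⟨ht, _ | _⟩⟩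
    rename_i s t
    have hl := hz.length_eq
    -- The cut term is an argument of the right premiss, unless it is itself the defective one.
    by_cases hsx : Tot σ (s.apps xs)
    · refine ⟨1, _, _, _, rfl, rfl, forall₂_snoc hz hsx, fun hu =>
        h (.of_headRed (Contr.headRed (.cut _ _ _ _ _ _ hl.symm)) hf hu),
        valDescends_of_eq (by simp [Rule.CondPrincipal]) fun a b hab => ?_⟩
      obtain ⟨rfl, h1⟩ := hab
      rw [List.getElem?_append_left (h1.trans_eq hl)]
    · refine ⟨0, _, _, _, rfl, rfl, hz, hsx,
        valDescends_of_eq (by simp [Rule.CondPrincipal]) fun a b hab => ?_⟩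
      obtain ⟨rfl, h1⟩ := hab
      rfl
  | L σs ρ σ τ =>
    rcases hp with _ | ⟨hs, _ | ⟨ht, _ | _⟩⟩
    rename_i s t
    obtain ⟨xs, ys, rfl, hx, hy⟩ := forall₂_append_inv hz
    rcases hy with _ | ⟨ha, _ | _⟩
    have hl := hx.length_eq
    by_cases hsx : Tot ρ (s.apps xs)
    · refine ⟨1, _, _, _, rfl, rfl, forall₂_snoc hx (ha.2 _ hsx), fun hu =>
        h (.of_headRed (Contr.headRed (.L _ _ _ _ _ _ _ _ hl.symm)) hf hu),
        valDescends_of_eq (by simp [Rule.CondPrincipal]) fun a b hab => ?_⟩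
      obtain ⟨rfl, h1⟩ := hab
      rw [List.getElem?_append_left (by omega), List.getElem?_append_left (by omega)]
    · refine ⟨0, _, _, _, rfl, rfl, hx, hsx,
        valDescends_of_eq (by simp [Rule.CondPrincipal]) fun a b hab => ?_⟩
      obtain ⟨rfl, h1⟩ := hab
      rw [List.getElem?_append_left (by omega)]
  | R σs σ τ =>
    rcases hp with _ | ⟨ht, _ | _⟩
    have hl := hz.length_eq
    obtain ⟨a, ha, h⟩ : ∃ a, Tot σ a ∧ ¬ Tot τ (((const (.R σs σ τ)).apps (_ :: xs)).app a) := by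
      by_contra! hc
      exact h ⟨hf, hc⟩
    have hf' := IsFarc.app hf ha.isFarc
    rw [← apps_snoc] at h
    erw [← apps_snoc] at hf'
    refine ⟨0, _, _, _, rfl, rfl, forall₂_snoc hz ha, fun hu =>
      h (.of_headRed (Contr.headRed (.R _ _ _ _ _ _ hl.symm)) hf' hu),
      valDescends_of_eq (by simp [Rule.CondPrincipal]) fun a b hab => ?_⟩
    obtain ⟨rfl, h1⟩ := hab
    rw [List.getElem?_append_left (h1.trans_eq hl)]
  | zero =>
    rcases hp with _ | _
    rcases hz with _ | _
    exact (h ⟨hf, 0, Val.zero⟩).elim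
  | succ =>
    rcases hp with _ | _
    rcases hz with _ | ⟨hx, _ | _⟩
    obtain ⟨_, n, hn⟩ := hx
    exact (h ⟨hf, n + 1, val_succ_iff.2 hn⟩).elim
  | cond σs τ =>
    rcases hp with _ | ⟨hs, _ | ⟨ht, _ | _⟩⟩
    obtain ⟨xs, ys, rfl, hx, hy⟩ := forall₂_append_inv hz
    rcases hy with _ | ⟨⟨hu, n, hn⟩, _ | _⟩
    have hl := hx.length_eq
    cases n with
    | zero =>
      obtain ⟨_, _, _, hn⟩ := hn
      refine ⟨0, _, _, _, rfl, rfl, hx, fun hu => h (.of_headRed (.condZero _ _ _ hl.symm hn) hf hu), ?_⟩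
      rintro a b (⟨rfl, h1⟩ | ⟨h1, _⟩) x hxa
      · rw [List.getElem?_append_left (by omega)] at hxa
        refine ⟨x, hxa, fun n hn => ⟨n, le_rfl, hn, ?_⟩⟩
        rintro ⟨σs', τ', h2, rfl⟩
        cases h2
        omega
      · omega
    | succ n =>
      obtain ⟨i, y, hi, hy, hn'⟩ := exists_ev_succ hu hn
      refine ⟨1, _, _, _, rfl, rfl, forall₂_snoc hx ⟨hy, n, hn'⟩, fun hu =>
        h (.of_headRed (.condSucc _ _ _ hl.symm hi) hf hu), ?_⟩
      rintro a b (⟨rfl, h1⟩ | ⟨_, rfl, rfl⟩) x hxa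
      · rw [List.getElem?_append_left (by omega)] at hxa
        refine ⟨x, by rw [List.getElem?_append_left (by omega), hxa], fun n hn =>
          ⟨n, le_rfl, hn, ?_⟩⟩
        rintro ⟨σs', τ', h2, rfl⟩
        cases h2
        omega
      · simp only [hl, List.getElem?_concat_length, Option.some.injEq] at hxa
        subst hxa
        refine ⟨y, by simp [hl], fun m hm => ?_⟩
        cases hm.unique hn
        exact ⟨n, by omega, hn', by omega⟩

theorem Rule.tot (r : Rule) : Tot r.toTy (const r : Coterm V) := by
  rw [Rule.toTy_eq]
  refine .of_forall_apps (Rule.toTy_eq r ▸ IsFarc.const r) fun zs hz => ?_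
  obtain ⟨ps, xs, rfl, hp, hx⟩ := forall₂_append_inv hz
  by_contra h
  obtain ⟨i, S, p, ys, hS, hpi, hy, hpy, -⟩ :=
    exists_premise_not_tot r (isFarc_of_forall₂_tot hp) hx h
  refine hpy (Tot.apps ?_ hy)
  rw [List.forall₂_iff_get] at hp
  obtain ⟨h1, rfl⟩ := List.getElem?_eq_some_iff.1 hS
  obtain ⟨h2, rfl⟩ := List.getElem?_eq_some_iff.1 hpi
  have := hp.2 i (by simpa using h1) h2
  simp only [List.get_eq_getElem, List.getElem_map] at this
  exact this

/-! ### Progressing coderivations are hereditarily total -/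

/-- A regular coderivation together with hereditarily total arguments for which its result is not
hereditarily total. -/
structure Counterexample (V : Ty → Type) : Type where
  tree : RuleTree
  args : List (Coterm V)
  isCoderivation : tree.IsCoderivation
  isRegular : tree.IsRegular
  tot_args : List.Forall₂ Tot tree.sequent.ctx args
  not_tot : ¬ Tot tree.sequent.goal ((tree.toCoterm V).apps args)

theorem Counterexample.exists_child (c : Counterexample V) :
    ∃ (i : ℕ) (c' : Counterexample V), c.tree.IsChild i c'.tree ∧
      ValDescends c.tree.rule i c.args c'.args := by
  obtain ⟨d, xs, hd, hr, hx, h⟩ := c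
  rw [RuleTree.toCoterm_eq_apps, ← apps_append] at h
  obtain ⟨i, S, p, ys, hS, hpi, hy, hpy, hv⟩ := exists_premise_not_tot d.rule
    (RuleTree.children_forall₂ IsFarc hd fun i => .coder _ (hd.child i) (hr.child i)) hx h
  obtain ⟨h1, rfl⟩ := List.getElem?_eq_some_iff.1 hS
  obtain ⟨h2, rfl⟩ := List.getElem?_eq_some_iff.1 hpi
  have hs := hd.sequent_child ⟨i, h1⟩
  refine ⟨i, ⟨d.child ⟨i, h1⟩, ys, hd.child _, hr.child _, ?_, ?_⟩, ⟨h1, rfl⟩, hv⟩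
  · rw [hs]; exact hy
  · rw [hs]; simpa using hpy

/-- By infinite descent: a counterexample would yield an infinite branch of counterexamples, and
the values along a progressing thread of that branch would decrease for ever. -/
theorem RuleTree.tot {d : RuleTree} (hd : d.IsCoderivation) (hr : d.IsRegular)
    (hp : d.IsProgressing) : Tot d.sequent.toTy (d.toCoterm V) := by
  refine .of_forall_apps (.coder d hd hr) fun xs hx => ?_
  by_contra hn
  choose i next hchild hdesc using fun c : Counterexample V => c.exists_child
  let s : ℕ → Counterexample V := fun n => n.rec ⟨d, xs, hd, hr, hx, hn⟩ fun _ c => next c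
  obtain ⟨k, p, hN, hA, hC⟩ := hp (fun n => (s n).tree) (fun n => i (s n)) rfl
    fun n => hchild (s n)
  -- `step` and `steps` follow the thread `p` from node `k + n` upwards, by one or more nodes.
  have step : ∀ n x v, (s (k + n)).args[p n]? = some x → Val v x →
      ∃ y, (s (k + (n + 1))).args[p (n + 1)]? = some y ∧
        ∃ m ≤ v, Val m y ∧ ((s (k + n)).tree.rule.CondPrincipal (p n) → m < v) := by
    intro n x v hx hv
    obtain ⟨y, hy, h⟩ := hdesc (s (k + n)) _ _ (hA n) x hx
    exact ⟨y, hy, h v hv⟩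
  have steps : ∀ n x v, (s (k + n)).args[p n]? = some x → Val v x → ∀ j,
      ∃ y, (s (k + (n + j))).args[p (n + j)]? = some y ∧ ∃ m ≤ v, Val m y := by
    intro n x v hx hv j
    induction j with
    | zero => exact ⟨x, hx, v, le_rfl, hv⟩
    | succ j ih =>
      obtain ⟨y, hy, m, hm, hmy⟩ := ih
      obtain ⟨z, hz, l, hl, hlz, -⟩ := step _ y m hy hmy
      exact ⟨z, hz, l, hl.trans hm, hlz⟩
  have descent : ∀ v n x, (s (k + n)).args[p n]? = some x → ¬ Val v x := by
    intro v
    induction v using Nat.strong_induction_on with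
    | _ v ih =>
      intro n x hx hv
      obtain ⟨m, hm, hc⟩ := hC n
      obtain ⟨j, rfl⟩ := Nat.exists_eq_add_of_le hm
      obtain ⟨y, hy, w, hw, hwy⟩ := steps n x v hx hv j
      obtain ⟨z, hz, l, -, hlz, hl⟩ := step _ y w hy hwy
      exact ih l ((hl hc).trans_le hw) (n + j + 1) z hz hlz
  obtain ⟨h1, h2⟩ := List.getElem?_eq_some_iff.1 (hN 0)
  have ht := List.forall₂_iff_get.1 (s (k + 0)).tot_args
  have h3 := ht.2 (p 0) h1 (ht.1 ▸ h1)
  simp only [List.get_eq_getElem, h2] at h3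
  obtain ⟨_, v, hv⟩ := h3
  exact descent v 0 _ (List.getElem?_eq_getElem _) hv

theorem CTConst.tot {σ : Ty} (c : CTConst σ) : Tot σ (c.toCoterm V) := by
  cases c with
  | rule r => exact r.tot
  | coder d hd hr hp => exact RuleTree.tot hd hr hp

/-! ### Testing two numbers for equality -/

/-- The nodes of a regular coderivation of `N, N ⇒ N` with root `test`, which peels successors off
its two arguments in turn. It yields `0` if both are used up together, and otherwise runs into the
infinite computation of `loop`. -/
inductive TestNode : Type
  | test
  | left
  | zero
  | forget
  | loop
  | ident
  | swap
  | right

namespace TestNode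

/-- The step at a node. -/
def rule : TestNode → Rule
  | test => .cond [.N] .N
  | left => .cond [] .N
  | zero => .zero
  | forget => .wk [] .N .N
  | loop => .cut [] .N .N
  | ident => .id .N
  | swap => .ex [] .N .N [] .N
  | right => .cond [.N] .N

/-- The children of a node. -/
def next : TestNode → List TestNode
  | test => [left, swap]
  | left => [zero, forget]
  | zero => []
  | forget => [loop]
  | loop => [loop, ident]
  | ident => []
  | swap => [right]
  | right => [forget, test]

theorem length_next (a : TestNode) : a.next.length = a.rule.premises.length := by
  cases a <;> rfl

/-- One layer of the coderivation that unfolds from a node. -/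
def step (a : TestNode) : ruleFunctor TestNode :=
  ⟨a.rule, fun i : Fin _ => a.next.get (i.cast a.length_next.symm)⟩

/-- The coderivation that unfolds from a node. -/
def tree (a : TestNode) : RuleTree := PFunctor.M.corec step a

theorem tree_eq (a : TestNode) : a.tree = PFunctor.M.mk (F := ruleFunctor)
    ⟨a.rule, fun i : Fin _ => (a.next.get (i.cast a.length_next.symm)).tree⟩ :=
  PFunctor.M.corec_def step a

theorem rule_tree (a : TestNode) : a.tree.rule = a.rule := by
  rw [tree_eq]; rfl

theorem toCoterm_mk (r : Rule) (f : Fin r.premises.length → RuleTree) :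
    RuleTree.toCoterm V (PFunctor.M.mk (F := ruleFunctor) ⟨r, f⟩) =
      (const r).apps (List.ofFn fun i => (f i).toCoterm V) :=
  RuleTree.toCoterm_eq_apps V _

/-- The coterm of the coderivation that unfolds from a node. -/
def coterm (V : Ty → Type) (a : TestNode) : Coterm V := a.tree.toCoterm V

theorem coterm_eq (a : TestNode) : coterm V a = (const a.rule).apps (a.next.map (coterm V)) := by
  conv_lhs => rw [coterm, tree_eq]
  refine (toCoterm_mk _ _).trans ?_
  cases a <;> rfl

theorem test_eq : coterm V test = (const (.cond [.N] .N)).apps [coterm V left, coterm V swap] :=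
  coterm_eq test

theorem left_eq : coterm V left = (const (.cond [] .N)).apps [coterm V zero, coterm V forget] :=
  coterm_eq left

theorem zero_eq : coterm V zero = const .zero := coterm_eq zero

theorem forget_eq : coterm V forget = (const (.wk [] .N .N)).apps [coterm V loop] :=
  coterm_eq forget

theorem loop_eq : coterm V loop = (const (.cut [] .N .N)).apps [coterm V loop, coterm V ident] :=
  coterm_eq loop

theorem ident_eq : coterm V ident = const (.id .N) := coterm_eq ident

theorem swap_eq : coterm V swap = (const (.ex [] .N .N [] .N)).apps [coterm V right] :=
  coterm_eq swap

theorem right_eq : coterm V right = (const (.cond [.N] .N)).apps [coterm V forget, coterm V test] :=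
  coterm_eq right

theorem child_tree (a : TestNode) (i : Fin a.tree.rule.premises.length) :
    ∃ h : i < a.next.length, a.tree.child i = (a.next.get ⟨i, h⟩).tree := by
  have h : (i : ℕ) < a.next.length := by
    rw [length_next, ← rule_tree]; exact i.2
  refine ⟨h, ?_⟩
  have key : ∀ (d : RuleTree) (_ : d = a.tree) (i : ℕ) (hi : i < d.rule.premises.length)
      (h : i < a.next.length), d.child ⟨i, hi⟩ = (a.next.get ⟨i, h⟩).tree := by
    intro d hd i hi h
    rw [tree_eq] at hd
    subst hd
    rfl
  exact key _ rfl i i.2 h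

theorem exists_of_isSub {a : TestNode} {d : RuleTree} (h : a.tree.IsSub d) :
    ∃ b : TestNode, d = b.tree := by
  induction h with
  | refl => exact ⟨a, rfl⟩
  | tail _ h ih =>
    obtain ⟨b, rfl⟩ := ih
    obtain ⟨i, hi, rfl⟩ := h
    obtain ⟨h, e⟩ := b.child_tree ⟨i, hi⟩
    exact ⟨_, e⟩

theorem isCoderivation (a : TestNode) : a.tree.IsCoderivation := by
  intro d hd i
  obtain ⟨b, rfl⟩ := exists_of_isSub hd
  obtain ⟨h, e⟩ := b.child_tree i
  rw [e]
  have key : ∀ (r : Rule) (_ : r = b.rule) (i : ℕ) (hi : i < r.premises.length)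
      (h : i < b.next.length), (b.next.get ⟨i, h⟩).tree.sequent = r.premises.get ⟨i, hi⟩ := by
    rintro r rfl m hm h
    unfold RuleTree.sequent
    rw [rule_tree]
    cases b <;> simp only [next, List.length_cons, List.length_nil] at h <;>
      interval_cases m <;> rfl
  exact key _ b.rule_tree i i.2 h

theorem isRegular (a : TestNode) : a.tree.IsRegular := by
  refine Set.Finite.subset (Set.toFinite {test.tree, left.tree, zero.tree, forget.tree, loop.tree,
    ident.tree, swap.tree, right.tree}) fun d hd => ?_
  obtain ⟨b, rfl⟩ := exists_of_isSub hd
  cases b <;> simp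

theorem isFarc (a : TestNode) :
    IsFarc (arrows a.rule.conclusion.ctx a.rule.conclusion.goal) (coterm V a) := by
  have := IsFarc.coder (V := V) a.tree a.isCoderivation a.isRegular
  rwa [RuleTree.sequent, rule_tree] at this

-- The coterm is infinite; it is unfolded by the equations above only.
attribute [irreducible] coterm

theorem not_ev_loop (k : ℕ) (w : Coterm V) : ¬ Ev k (coterm V loop) w := by
  induction k using Nat.strong_induction_on with
  | _ k ih =>
    intro h
    rw [loop_eq] at h
    obtain ⟨i, rfl, h1⟩ := h.contr_inv (e := [])
      (Contr.cut [] .N .N (coterm V loop) (coterm V ident) [] rfl)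
    rw [ident_eq] at h1
    obtain ⟨j, rfl, h2⟩ := h1.contr_inv (e := []) (Contr.id .N (coterm V loop))
    exact ih j (by omega) h2

theorem not_ev_forget (k : ℕ) (u w : Coterm V) : ¬ Ev k ((coterm V forget).app u) w := by
  intro h
  rw [forget_eq] at h
  obtain ⟨i, rfl, h1⟩ := h.contr_inv (e := []) (Contr.wk [] .N .N (coterm V loop) u [] rfl)
  exact not_ev_loop _ _ h1

theorem contr_swap (u v : Coterm V) :
    Contr (.ex [] .N .N [] .N) [coterm V right, u, v] ((coterm V right).apps [v, u]) :=
  Contr.ex [] .N .N [] .N (coterm V right) u v [] [] rfl rfl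

/-- If the test yields a value at all, then this is `0`, and both arguments have the same value, which
shows up within the contractions that the test takes. -/
theorem obs_of_ev_test {k : ℕ} {u v w : Coterm V} (h : Ev k ((coterm V test).apps [u, v]) w) :
    w = const .zero ∧ ∃ n, Obs (.num n) k u ∧ Obs (.num n) k v := by
  induction k using Nat.strong_induction_on generalizing u v w with
  | _ k ih =>
    rw [test_eq] at h
    obtain ⟨i, j, rfl, ⟨h1, h2⟩ | ⟨v', h1, h2⟩⟩ := h.cond_inv (xs := [u]) (e := []) rfl
    · rw [left_eq] at h2
      obtain ⟨i', j', rfl, ⟨h3, h4⟩ | ⟨u', h3, h4⟩⟩ := h2.cond_inv (xs := []) (e := []) rfl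
      · rw [zero_eq] at h4
        exact ⟨h4.zero_inv.2, 0, ⟨_, by omega, h3⟩, ⟨_, by omega, h1⟩⟩
      · exact (not_ev_forget _ _ _ h4).elim
    · rw [swap_eq] at h2
      obtain ⟨j, rfl, h5⟩ := h2.contr_inv (e := []) (contr_swap u v')
      change Ev j ((coterm V right).apps [v', u]) w at h5
      rw [right_eq] at h5
      obtain ⟨i', j', rfl, ⟨h3, h4⟩ | ⟨u', h3, h4⟩⟩ := h5.cond_inv (xs := [v']) (e := []) rfl
      · exact (not_ev_forget _ _ _ h4).elim
      · obtain ⟨hw, n, hv, hu⟩ := ih j' (by omega) h4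
        exact ⟨hw, n + 1, ⟨_, _, _, by omega, h3, hu⟩, ⟨_, _, _, by omega, h1, hv⟩⟩

theorem exists_ev_test {n : ℕ} {u v : Coterm V} (hu : Val n u) (hv : Val n v) :
    ∃ k, Ev k ((coterm V test).apps [u, v]) (const .zero) := by
  induction n generalizing u v with
  | zero =>
    obtain ⟨_, i, _, hu⟩ := hu
    obtain ⟨_, j, _, hv⟩ := hv
    have h1 := hu.condZero (xs := []) (e := []) (σs := []) .N (coterm V forget) rfl
      (s := coterm V zero) (w := const .zero) (j := 0) (by rw [zero_eq]; exact .zero)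
    refine ⟨j + (i + 0 + 1) + 1, ?_⟩
    rw [test_eq]
    refine hv.condZero (xs := [u]) (e := []) (σs := [.N]) .N (coterm V swap) rfl ?_
    rw [left_eq]
    exact h1
  | succ n ih =>
    obtain ⟨_, i, _, u', _, hu, hu'⟩ := hu
    obtain ⟨_, j, _, v', _, hv, hv'⟩ := hv
    obtain ⟨k, h⟩ := ih ⟨_, hv'⟩ ⟨_, hu'⟩
    have h1 := hu.condSucc (xs := [v']) (e := []) (σs := [.N]) .N (coterm V forget) rfl h
    have h2 : Ev (i + k + 1) ((coterm V right).apps [v', u]) (const .zero) := by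
      rw [right_eq]; exact h1
    refine ⟨j + (i + k + 1 + 1) + 1, ?_⟩
    rw [test_eq]
    refine hv.condSucc (xs := [u]) (e := []) (σs := [.N]) .N (coterm V left) rfl ?_
    rw [swap_eq]
    exact Ev.contr [] (contr_swap u v') h2

end TestNode

/-! ### Meets of functionals -/

/-- `constFun τ Γ c` is the constant function with value `c`, of type `τ`, in arguments of
types `Γ`. -/
def constFun (τ : Ty) : List Ty → Coterm V → Coterm V
  | [], c => c
  | σ :: Γ, c => (const (.wk [] σ (arrows Γ τ))).app (constFun τ Γ c)

theorem isFarc_constFun {τ : Ty} (Γ : List Ty) {c : Coterm V} (h : IsFarc τ c) :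
    IsFarc (arrows Γ τ) (constFun τ Γ c) := by
  induction Γ with
  | nil => exact h
  | cons σ Γ ih => exact .app (.const (.wk [] σ (arrows Γ τ))) ih

theorem headRed_constFun (τ : Ty) {Γ : List Ty} (c : Coterm V) {xs : List (Coterm V)}
    (hx : xs.length = Γ.length) : HeadRed ((constFun τ Γ c).apps xs) c := by
  induction Γ generalizing xs with
  | nil =>
    obtain rfl := List.length_eq_zero_iff.1 hx
    exact .refl _
  | cons σ Γ ih =>
    obtain _ | ⟨x, xs⟩ := xs
    · simp at hx
    · exact ((Contr.wk [] σ (arrows Γ τ) (constFun τ Γ c) x [] rfl).headRed.apps xs).trans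
        (ih (by simpa using hx))

/-- The meet of two numbers: `meet u v` has the value of `u` if `u` and `v` have the same value, and
has no value otherwise. -/
def meet : Coterm V :=
  (const (.cut [.N, .N] .N .N)).apps [TestNode.coterm V .test,
    (const (.cond [.N, .N] .N)).apps [(const (.wk [.N] .N .N)).app (const (.id .N)),
      (const (.wk [.N, .N] .N .N)).app (TestNode.coterm V .test)]]

theorem isFarc_meet : IsFarc (arrows [.N, .N] .N) (meet : Coterm V) := by
  have ht : IsFarc (arrows [.N, .N] .N) (TestNode.coterm V .test) := TestNode.test.isFarc
  refine .app (.app (.const (.cut [.N, .N] .N .N)) ht) ?_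
  refine .app (.app (.const (.cond [.N, .N] .N)) ?_) ?_
  · exact .app (.const (.wk [.N] .N .N)) (.const (.id .N))
  · exact .app (.const (.wk [.N, .N] .N .N)) ht

theorem headRed_meet (u v : Coterm V) : HeadRed (meet.apps [u, v])
    ((const (.cond [.N, .N] .N)).apps ((const (.wk [.N] .N .N)).app (const (.id .N)) ::
      (const (.wk [.N, .N] .N .N)).app (TestNode.coterm V .test) ::
      ([u, v] ++ [(TestNode.coterm V .test).apps [u, v]]))) :=
  (Contr.cut [.N, .N] .N .N (TestNode.coterm V .test) _ [u, v] rfl).headRed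

theorem headRed_wk_id (u v : Coterm V) :
    HeadRed (((const (.wk [.N] .N .N)).app (const (.id .N))).apps [u, v]) u :=
  (Contr.wk [.N] .N .N (const (.id .N)) v [u] rfl).headRed.trans (Contr.id .N u).headRed

/-- An observation on a term with value `n` holds of every other term with this value. No more
contractions are needed than those that show this value. -/
theorem Obs.of_num {n : ℕ} {o : Obsv} {i k : ℕ} {u v : Coterm V} (hu : Val n u)
    (hv : Obs (.num n) i v) (h : Obs o k u) : Obs o i v := by
  obtain ⟨j, hu⟩ := hu
  induction n generalizing o i j k u v with
  | zero =>
    cases o with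
    | bot => trivial
    | zero => exact hv
    | succ o =>
      obtain ⟨_, _, h1⟩ := hu
      obtain ⟨_, _, _, _, h2, _⟩ := h
      exact (app_ne_const (h2.unique h1)).elim
  | succ n ih =>
    obtain ⟨_, _, u', _, hu, hu'⟩ := hu
    cases o with
    | bot => trivial
    | zero =>
      obtain ⟨_, _, h2⟩ := h
      exact (app_ne_const (hu.unique h2)).elim
    | succ o =>
      obtain ⟨_, _, _, _, h2, h3⟩ := h
      obtain ⟨_, rfl⟩ := app_inj (hu.unique h2)
      obtain ⟨a, b, v', hab, hv, hv'⟩ := hv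
      exact ⟨a, b, v', hab, hv, ih hv' h3 _ hu'⟩

/-- The meet of two numbers lies below both of them. -/
theorem obs_meet {u v : Coterm V} {o : Obsv} {k : ℕ} (h : Obs o k (meet.apps [u, v])) :
    Obs o k u ∧ Obs o k v := by
  have h' := (headRed_meet u v).obs h
  obtain rfl | ⟨i, j, rfl, ⟨h1, h2⟩ | ⟨y, h1, _⟩⟩ := h'.cond_inv (xs := [u, v]) (e := []) rfl
  · exact ⟨trivial, trivial⟩
  · obtain ⟨_, n, hu, hv⟩ := TestNode.obs_of_ev_test h1
    have h3 := (headRed_wk_id u v).obs h2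
    exact ⟨h3.mono (by omega), (hv.of_num ⟨_, hu⟩ h3).mono (by omega)⟩
  · exact (app_ne_const (TestNode.obs_of_ev_test h1).1).elim

theorem val_meet {u v : Coterm V} {n : ℕ} (hu : Val n u) (hv : Val n v) :
    Val n (meet.apps [u, v]) := by
  obtain ⟨i, h⟩ := TestNode.exists_ev_test hu hv
  obtain ⟨_, hu⟩ := hu
  obtain ⟨j, h'⟩ := (headRed_wk_id u v).exists_obs hu
  exact (headRed_meet u v).exists_obs (h'.condZero (xs := [u, v]) (e := []) _ _ rfl h)

/-- The pointwise meet of two functionals with arguments of types `Γ` and values of type `N`. -/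
def funMeet (Γ : List Ty) (f g : Coterm V) : Coterm V :=
  (const (.cut Γ .N .N)).apps [g, (const (.cut Γ .N (.arr .N .N))).apps
    [f, constFun (arrows [.N, .N] .N) Γ meet]]

theorem isFarc_funMeet {Γ : List Ty} {f g : Coterm V} (hf : IsFarc (arrows Γ .N) f)
    (hg : IsFarc (arrows Γ .N) g) : IsFarc (arrows Γ .N) (funMeet Γ f g) := by
  refine .app (.app (.const (.cut Γ .N .N)) hg) ?_
  rw [show Sequent.toTy ⟨Γ ++ [Ty.N], .N⟩ = arrows Γ (.arr .N .N) from arrows_append _ _ _]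
  refine .app (.app (.const (.cut Γ .N (.arr .N .N))) hf) ?_
  rw [show Sequent.toTy ⟨Γ ++ [Ty.N], .arr .N .N⟩ = arrows Γ (.arr .N (.arr .N .N)) from
    arrows_append _ _ _]
  exact isFarc_constFun Γ isFarc_meet

theorem headRed_funMeet {Γ : List Ty} (f g : Coterm V) {xs : List (Coterm V)}
    (hx : xs.length = Γ.length) :
    HeadRed ((funMeet Γ f g).apps xs) (meet.apps [f.apps xs, g.apps xs]) := by
  refine (Contr.cut Γ .N .N g _ xs hx).headRed.trans ?_
  rw [apps_append]
  refine ((Contr.cut Γ .N (.arr .N .N) f _ xs hx).headRed.apps _).trans ?_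
  rw [apps_append]
  exact ((headRed_constFun _ meet hx).apps [f.apps xs]).apps [g.apps xs]

/-! ### Hereditarily total farcs are extensional -/

theorem conv_of_val {t t' : Farc V .N} {n : ℕ} (h : Val n t.1) (h' : Val n t'.1) : Conv t t' :=
  (conv_numeral_iff.2 h).trans (conv_numeral_iff.2 h').symm

theorem ExtEq.val {Γ : List Ty} {f g : Farc V (arrows Γ .N)} (h : ExtEq V _ f g)
    {xs : List (Coterm V)} (hx : List.Forall₂ Tot Γ xs) {n : ℕ} (hf : Val n (f.1.apps xs)) :
    Val n (g.1.apps xs) := by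
  induction hx with
  | nil => exact (Conv.val_iff h n).1 hf
  | @cons σ x Γ xs hx _ ih =>
    exact ih (f := Farc.app f ⟨x, hx.isFarc⟩) (g := Farc.app g ⟨x, hx.isFarc⟩)
      (h ⟨x, hx.isFarc⟩ (mem_HRset_iff.2 hx)) hf

/-- Two farcs above a common hereditarily total one are extensionally equal. -/
theorem extEq_of_rel {τ : Ty} {t₀ : Coterm V} (h₀ : Tot τ t₀) {t t' : Farc V τ}
    (h : ∀ k, Rel τ k t₀ t.1) (h' : ∀ k, Rel τ k t₀ t'.1) : ExtEq V τ t t' := by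
  induction τ generalizing t₀ with
  | N =>
    obtain ⟨_, n, hn⟩ := h₀
    exact conv_of_val (hn.of_rel h) (hn.of_rel h')
  | arr σ τ _ ih =>
    intro s hs
    exact ih (h₀.2 _ (mem_HRset_iff.1 hs)) (fun k => h k k le_rfl _ _ (s.2.rel k))
      fun k => h' k k le_rfl _ _ (s.2.rel k)

/-- Application of a hereditarily total farc `t` respects extensional equality. The meet of the two
arguments `f` and `g` is hereditarily total because they are extensionally equal; since it lies
below both, the value of `t` at the meet lies below the values at `f` and at `g`. -/
theorem extEq_app {σ τ : Ty} {t : Farc V (.arr σ τ)} {f g : Farc V σ} (ht : t ∈ HRset V _)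
    (hf : f ∈ HRset V _) (h : ExtEq V σ f g) : ExtEq V τ (t.app f) (t.app g) := by
  obtain ⟨Γ, rfl⟩ := exists_eq_arrows σ
  rw [mem_HRset_iff] at ht hf
  have hfarc := isFarc_funMeet f.2 g.2
  have tot : Tot (arrows Γ .N) (funMeet Γ f.1 g.1) := by
    refine .of_forall_apps hfarc fun xs hx => ⟨hfarc.apps (isFarc_of_forall₂_tot hx), ?_⟩
    obtain ⟨_, n, hn⟩ := hf.apps hx
    obtain ⟨k, hk⟩ := val_meet hn (h.val hx hn)
    exact ⟨n, (headRed_funMeet _ _ hx.length_eq.symm).exists_obs hk⟩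
  have obs : ∀ {j xs xs'}, Forall₃ (fun σ => Rel σ j) Γ xs xs' → ∀ {o},
      Obs o j ((funMeet Γ f.1 g.1).apps xs) → Obs o j (f.1.apps xs) ∧ Obs o j (g.1.apps xs) :=
    fun hx o ho => obs_meet ((headRed_funMeet _ _ hx.length_left).obs ho)
  refine extEq_of_rel (ht.2 _ tot) (fun k => t.2.rel k k le_rfl _ _ ?_)
    fun k => t.2.rel k k le_rfl _ _ ?_
  · exact Rel.of_forall_apps fun j _ xs xs' hx o ho => (f.2.rel j).apps hx o (obs hx ho).1
  · exact Rel.of_forall_apps fun j _ xs xs' hx o ho => (g.2.rel j).apps hx o (obs hx ho).2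

/-! ### Soundness of first-order reasoning in type structures -/

namespace StructureData

variable {M : StructureData} {Γ Δ : List Ty}

theorem IsTypeStructure.eval_mem (hM : M.IsTypeStructure) (a : M.Assignment Γ) {σ : Ty}
    (t : CTTerm Γ σ) : M.eval a t ∈ M.dom σ := by
  induction t with
  | var v => exact (a _ v).2
  | const c => exact hM.const_mem c
  | app t s iht ihs => exact hM.app_mem _ _ iht ihs

/-- The assignment that gives each variable `v` the value of the term `θ v`. -/
def Assignment.subst (hM : M.IsTypeStructure) (a : M.Assignment Δ) (θ : Subst Γ Δ) :
    M.Assignment Γ := fun σ v => ⟨M.eval a (θ σ v), hM.eval_mem a _⟩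

theorem eval_subst (hM : M.IsTypeStructure) (a : M.Assignment Δ) (θ : Subst Γ Δ) {σ : Ty}
    (t : CTTerm Γ σ) : M.eval a (t.subst θ) = M.eval (a.subst hM θ) t := by
  induction t with
  | var v => rfl
  | const c => rfl
  | app t s iht ihs => simp only [CTTerm.subst, eval, iht, ihs]

theorem subst_weaken (hM : M.IsTypeStructure) (a : M.Assignment Γ) {ρ : Ty} (x : M.dom ρ) :
    (a.cons x).subst hM (Subst.weaken Γ ρ) = a := rfl

theorem subst_cons (hM : M.IsTypeStructure) (a : M.Assignment Δ) (θ : Subst Γ Δ) {ρ : Ty}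
    (t : CTTerm Δ ρ) : a.subst hM (Subst.cons t θ) =
      (a.subst hM θ).cons ⟨M.eval a t, hM.eval_mem a t⟩ := by
  funext σ v
  cases v <;> rfl

theorem subst_lift (hM : M.IsTypeStructure) (a : M.Assignment Δ) (θ : Subst Γ Δ) {ρ : Ty}
    (x : M.dom ρ) : (a.cons x).subst hM (θ.lift ρ) = (a.subst hM θ).cons x := by
  funext σ v
  cases v with
  | zero => rfl
  | succ v => exact Subtype.ext (eval_subst hM _ _ _)

theorem sat_subst (hM : M.IsTypeStructure) (a : M.Assignment Δ) (θ : Subst Γ Δ)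
    (φ : Formula Γ) : M.Sat a (φ.subst θ) ↔ M.Sat (a.subst hM θ) φ := by
  induction φ generalizing Δ with
  | eq s t => simp only [Formula.subst, Sat, eval_subst hM]
  | bot => rfl
  | imp φ ψ ih1 ih2 => simp only [Formula.subst, Sat, ih1, ih2]
  | and φ ψ ih1 ih2 => simp only [Formula.subst, Sat, ih1, ih2]
  | or φ ψ ih1 ih2 => simp only [Formula.subst, Sat, ih1, ih2]
  | all σ φ ih => simp only [Formula.subst, Sat, ih, subst_lift]
  | ex σ φ ih => simp only [Formula.subst, Sat, ih, subst_lift]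

theorem sat_inst (hM : M.IsTypeStructure) (a : M.Assignment Γ) {ρ : Ty} (φ : Formula (ρ :: Γ))
    (t : CTTerm Γ ρ) :
    M.Sat a (φ.inst t) ↔ M.Sat (a.cons ⟨M.eval a t, hM.eval_mem a t⟩) φ := by
  rw [Formula.inst, sat_subst hM, subst_cons]
  rfl

theorem sat_weaken (hM : M.IsTypeStructure) (a : M.Assignment Γ) {ρ : Ty} (x : M.dom ρ)
    (φ : Formula Γ) : M.Sat (a.cons x) (φ.weaken ρ) ↔ M.Sat a φ := by
  rw [Formula.weaken, sat_subst hM, subst_weaken]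

/-- The interpretation of equality is a congruence on the domains. -/
structure IsCongruence (M : StructureData) : Prop where
  refl : ∀ {σ : Ty} (x : M.U σ), M.eq x x
  symm : ∀ {σ : Ty} {x y : M.U σ}, M.eq x y → M.eq y x
  trans : ∀ {σ : Ty} {x y z : M.U σ}, M.eq x y → M.eq y z → M.eq x z
  app : ∀ {σ τ : Ty} {t t' : M.U (.arr σ τ)} {s s' : M.U σ}, t ∈ M.dom _ → s ∈ M.dom _ →
    s' ∈ M.dom _ → M.eq t t' → M.eq s s' → M.eq (M.app t s) (M.app t' s')

theorem IsCongruence.eval (hM : M.IsTypeStructure) (hE : M.IsCongruence) {a b : M.Assignment Γ}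
    (h : ∀ σ v, M.eq (a σ v).1 (b σ v).1) {σ : Ty} (t : CTTerm Γ σ) :
    M.eq (M.eval a t) (M.eval b t) := by
  induction t with
  | var v => exact h _ v
  | const c => exact hE.refl _
  | app t s iht ihs =>
    exact hE.app (hM.eval_mem a t) (hM.eval_mem a s) (hM.eval_mem b s) iht ihs

theorem eq_cons {a b : M.Assignment Γ}
    (h : ∀ σ v, M.eq (a σ v).1 (b σ v).1) {ρ : Ty} {x y : M.dom ρ} (hxy : M.eq x.1 y.1) :
    ∀ σ v, M.eq (a.cons x σ v).1 (b.cons y σ v).1 := by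
  intro σ v
  cases v with
  | zero => exact hxy
  | succ v => exact h _ v

/-- Truth of arbitrary formulas, with quantifiers, depends on the assignment only up to the
interpretation of equality. -/
theorem IsCongruence.sat (hM : M.IsTypeStructure) (hE : M.IsCongruence) {a b : M.Assignment Γ}
    (h : ∀ σ v, M.eq (a σ v).1 (b σ v).1) (φ : Formula Γ) : M.Sat a φ ↔ M.Sat b φ := by
  induction φ with
  | eq s t =>
    have hs := hE.eval hM h s
    have ht := hE.eval hM h t
    exact ⟨fun h => hE.trans (hE.symm hs) (hE.trans h ht),
      fun h => hE.trans hs (hE.trans h (hE.symm ht))⟩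
  | bot => rfl
  | imp φ ψ ih1 ih2 => simp only [Sat, ih1 h, ih2 h]
  | and φ ψ ih1 ih2 => simp only [Sat, ih1 h, ih2 h]
  | or φ ψ ih1 ih2 => simp only [Sat, ih1 h, ih2 h]
  | all σ φ ih => exact forall_congr' fun x => ih (eq_cons h (hE.refl x.1))
  | ex σ φ ih => exact exists_congr fun x => ih (eq_cons h (hE.refl x.1))

theorem IsCongruence.sat_cons (hM : M.IsTypeStructure) (hE : M.IsCongruence) (a : M.Assignment Γ)
    {ρ : Ty} {x y : M.dom ρ} (h : M.eq x.1 y.1) (φ : Formula (ρ :: Γ)) :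
    M.Sat (a.cons x) φ ↔ M.Sat (a.cons y) φ :=
  hE.sat hM (eq_cons (fun _ _ => hE.refl _) h) φ

/-- Soundness: it suffices that the axioms are valid and that validity is closed under the rules of
induction and, if present, extensionality. -/
theorem sat_of_proves (hM : M.IsTypeStructure) {ER : Prop}
    (hax : ∀ {Γ : List Ty} {φ : Formula Γ}, CTAxiom φ → M.Valid φ)
    (hind : ∀ {Γ : List Ty} (φ : Formula (Ty.N :: Γ)), M.Valid (φ.inst CTTerm.zero) →
      M.Valid (Formula.imp φ φ.instSucc) → ∀ t : CTTerm Γ Ty.N, M.Valid (φ.inst t))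
    (hext : ER → ∀ {Γ : List Ty} {σ τ : Ty} (s t : CTTerm Γ (Ty.arr σ τ)),
      M.Valid (extPremise s t) → M.Valid (Formula.eq s t))
    {H : List (Formula Γ)} {φ : Formula Γ} (h : Proves ER H φ) :
    ∀ a : M.Assignment Γ, (∀ ψ ∈ H, M.Sat a ψ) → M.Sat a φ := by
  induction h with
  | ax h => exact fun a _ => hax h a
  | ind φ _ _ _ t ih0 ih1 =>
    exact fun a _ => hind φ (fun a => ih0 a (by simp)) (fun a => ih1 a (by simp)) t a
  | ext her s t _ ih => exact fun a _ => hext her s t (fun a => ih a (by simp)) a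
  | subst θ _ ih => exact fun a _ => (sat_subst hM a θ _).2 (ih _ (by simp))
  | hyp h => exact fun a ha => ha _ h
  | byContra _ ih =>
    intro a ha
    by_contra hn
    exact ih a (List.forall_mem_cons.2 ⟨hn, ha⟩)
  | impI _ ih => exact fun a ha hφ => ih a (List.forall_mem_cons.2 ⟨hφ, ha⟩)
  | impE _ _ ih1 ih2 => exact fun a ha => ih1 a ha (ih2 a ha)
  | andI _ _ ih1 ih2 => exact fun a ha => ⟨ih1 a ha, ih2 a ha⟩
  | andE₁ _ ih => exact fun a ha => (ih a ha).1
  | andE₂ _ ih => exact fun a ha => (ih a ha).2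
  | orI₁ _ ih => exact fun a ha => .inl (ih a ha)
  | orI₂ _ ih => exact fun a ha => .inr (ih a ha)
  | orE _ _ _ ih ih1 ih2 =>
    intro a ha
    rcases ih a ha with h | h
    · exact ih1 a (List.forall_mem_cons.2 ⟨h, ha⟩)
    · exact ih2 a (List.forall_mem_cons.2 ⟨h, ha⟩)
  | allI _ ih =>
    refine fun a ha x => ih _ fun ψ hψ => ?_
    obtain ⟨χ, hχ, rfl⟩ := List.mem_map.1 hψ
    exact (sat_weaken hM a x χ).2 (ha _ hχ)
  | allE _ t ih => exact fun a ha => (sat_inst hM a _ t).2 (ih a ha _)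
  | exI t _ ih => exact fun a ha => ⟨_, (sat_inst hM a _ t).1 (ih a ha)⟩
  | exE _ _ ih ih' =>
    intro a ha
    obtain ⟨x, hx⟩ := ih a ha
    refine (sat_weaken hM a x _).1 (ih' _ (List.forall_mem_cons.2 ⟨hx, fun ψ hψ => ?_⟩))
    obtain ⟨χ, hχ, rfl⟩ := List.mem_map.1 hψ
    exact (sat_weaken hM a x χ).2 (ha _ hχ)

end StructureData

/-! ### Terms that denote the same coterm -/

theorem Spine.toCoterm_ne_var {x : Spine} {σ : Ty} {v : V σ} : x.toCoterm V ≠ Coterm.var v := by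
  obtain ⟨d, _ | k, h⟩ := x
  · rw [Spine.toCoterm_zero]; exact Coterm.const_ne_var
  · rw [Spine.toCoterm_succ]; exact Coterm.app_ne_var

/-- Whether two spines denote the same coterm does not depend on the variables. -/
theorem Spine.toCoterm_congr {W : Ty → Type} {x y : Spine} (h : x.toCoterm V = y.toCoterm V) :
    x.toCoterm W = y.toCoterm W := by
  refine PFunctor.M.bisim (fun u v => ∃ x y : Spine, x.toCoterm V = y.toCoterm V ∧
    u = x.toCoterm W ∧ v = y.toCoterm W) ?_ _ _ ⟨x, y, h, rfl, rfl⟩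
  rintro _ _ ⟨⟨d, _ | k, hk⟩, ⟨e, _ | l, hl⟩, h, rfl, rfl⟩
  · rw [Spine.toCoterm_zero, Spine.toCoterm_zero] at h
    rw [Spine.toCoterm_zero, Spine.toCoterm_zero, Coterm.const_inj h]
    exact ⟨_, _, _, rfl, rfl, fun i : Empty => i.elim⟩
  · rw [Spine.toCoterm_zero, Spine.toCoterm_succ] at h
    exact (Coterm.app_ne_const h.symm).elim
  · rw [Spine.toCoterm_zero, Spine.toCoterm_succ] at h
    exact (Coterm.app_ne_const h).elim
  · rw [Spine.toCoterm_succ, Spine.toCoterm_succ] at h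
    rw [Spine.toCoterm_succ, Spine.toCoterm_succ]
    obtain ⟨h1, h2⟩ := Coterm.app_inj h
    refine ⟨_, _, _, rfl, rfl, fun i : Bool => ?_⟩
    cases i
    · exact ⟨_, _, h1, rfl, rfl⟩
    · exact ⟨_, _, h2, rfl, rfl⟩

/-- Constants denote coterms of spines: a step is the spine without premisses of a tree with this
step at the root. -/
theorem CTConst.exists_spine {σ : Ty} (c : CTConst σ) :
    ∃ x : Spine, ∀ V, c.toCoterm V = x.toCoterm V := by
  cases c with
  | rule r =>
    -- Only the root matters here, so that any tree may serve as a child.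
    let d : RuleTree := PFunctor.M.mk (F := ruleFunctor) ⟨r, fun _ => TestNode.zero.tree⟩
    exact ⟨⟨d, 0, Nat.zero_le _⟩, fun V => (Spine.toCoterm_zero V d _).symm⟩
  | coder d hd hr hp => exact ⟨Spine.full d, fun V => rfl⟩

/-! ### The structures of hereditarily total farcs -/

/-- The structure of hereditarily total farcs in which equality is interpreted by `E`. -/
def farcStructure (V : Ty → Type) (E : ∀ {σ : Ty}, Farc V σ → Farc V σ → Prop) :
    StructureData where
  U := Farc V
  dom := HRset V
  app := Farc.app
  const := fun c => ⟨c.toCoterm V, c.isFarc V⟩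
  eq := E

section

variable {E : ∀ {σ : Ty}, Farc V σ → Farc V σ → Prop} {Γ : List Ty}

theorem HRset_nonempty (σ : Ty) : (HRset V σ).Nonempty := by
  obtain ⟨Γ, rfl⟩ := exists_eq_arrows σ
  have hf : IsFarc (arrows Γ .N) (constFun .N Γ (Coterm.const .zero : Coterm V)) :=
    isFarc_constFun Γ (.const .zero)
  refine ⟨⟨_, hf⟩, mem_HRset_iff.2 (.of_forall_apps hf fun xs hx => ?_)⟩
  exact .of_headRed (headRed_constFun _ _ hx.length_eq.symm)
    (hf.apps (isFarc_of_forall₂_tot hx)) ⟨.const .zero, 0, .zero⟩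

theorem farcStructure_isTypeStructure : (farcStructure V E).IsTypeStructure where
  nonempty := HRset_nonempty
  app_mem _ s ht hs := ht s hs
  const_mem c := mem_HRset_iff.2 c.tot

/-- A term that denotes the same coterm as a spine, which has no variables, has the coterm of that
spine as its value. -/
theorem Spine.toCoterm_eq_eval (a : (farcStructure V E).Assignment Γ) {σ : Ty} {t : CTTerm Γ σ}
    {x : Spine} (h : x.toCoterm (Var Γ) = t.toCoterm) :
    x.toCoterm V = ((farcStructure V E).eval a t).1 := by
  induction t generalizing x with
  | var v => exact (Spine.toCoterm_ne_var h).elim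
  | const c =>
    obtain ⟨y, hy⟩ := c.exists_spine
    exact (Spine.toCoterm_congr (h.trans (hy _))).trans (hy _).symm
  | app t s iht ihs =>
    obtain ⟨d, _ | k, hk⟩ := x
    · rw [Spine.toCoterm_zero] at h
      exact (Coterm.app_ne_const h.symm).elim
    · rw [Spine.toCoterm_succ] at h
      obtain ⟨h1, h2⟩ := Coterm.app_inj h
      rw [Spine.toCoterm_succ, iht h1]
      exact congrArg _ (ihs h2)

/-- The value of a term depends only on the coterm that the term denotes. -/
theorem eval_eq_of_toCoterm_eq (a : (farcStructure V E).Assignment Γ) {σ τ : Ty} {s : CTTerm Γ σ}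
    {t : CTTerm Γ τ} (h : s.toCoterm = t.toCoterm) :
    ((farcStructure V E).eval a s).1 = ((farcStructure V E).eval a t).1 := by
  induction s generalizing τ with
  | var v =>
    cases t with
    | var w =>
      obtain ⟨rfl, h⟩ := Coterm.var_inj h
      rw [eq_of_heq h]
    | const c =>
      obtain ⟨y, hy⟩ := c.exists_spine
      exact (Spine.toCoterm_ne_var ((hy _).symm.trans h.symm)).elim
    | app t s => exact (Coterm.app_ne_var h.symm).elim
  | const c =>
    obtain ⟨y, hy⟩ := c.exists_spine
    exact (hy V).trans (Spine.toCoterm_eq_eval a ((hy _).symm.trans h))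
  | app s₁ s₂ ih₁ ih₂ =>
    cases t with
    | var w => exact (Coterm.app_ne_var h).elim
    | const c =>
      obtain ⟨y, hy⟩ := c.exists_spine
      exact ((hy V).trans (Spine.toCoterm_eq_eval a ((hy _).symm.trans h.symm))).symm
    | app t₁ t₂ =>
      obtain ⟨h1, h2⟩ := Coterm.app_inj h
      exact congr (congrArg Coterm.app (ih₁ h1)) (ih₂ h2)

/-- The coterm of the value of a term. -/
abbrev evalCoterm (a : (farcStructure V E).Assignment Γ) {σ : Ty} (t : CTTerm Γ σ) : Coterm V :=
  ((farcStructure V E).eval a t).1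

/-- The coterms of the values of a list of terms. -/
def Args.values (a : (farcStructure V E).Assignment Γ) : {σs : List Ty} → Args Γ σs →
    List (Coterm V)
  | _, .nil => []
  | _, .cons x xs => ((farcStructure V E).eval a x).1 :: xs.values a

theorem Args.length_values (a : (farcStructure V E).Assignment Γ) {σs : List Ty} (xs : Args Γ σs) :
    (xs.values a).length = σs.length := by
  induction xs with
  | nil => rfl
  | cons x xs ih => simp [values, ih]

theorem Args.values_append (a : (farcStructure V E).Assignment Γ) {σs ρs : List Ty}
    (xs : Args Γ σs) (ys : Args Γ ρs) :
    (xs.append ys).values a = xs.values a ++ ys.values a := by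
  induction xs with
  | nil => rfl
  | cons x xs ih => simp [values, append, ih]

theorem eval_apps (a : (farcStructure V E).Assignment Γ) {σs : List Ty} {τ : Ty}
    (t : CTTerm Γ (arrows σs τ)) (xs : Args Γ σs) :
    ((farcStructure V E).eval a (t.apps xs)).1 =
      ((farcStructure V E).eval a t).1.apps (xs.values a) := by
  induction xs with
  | nil => rfl
  | cons x xs ih => exact ih _

/-- `E` is a congruence of hereditarily total farcs that contains conversion, and agrees with it at
type `N`. Under these conditions hereditarily total farcs with equality interpreted by `E` satisfy
the axioms of `CT` and the rule of induction. -/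
structure IsFarcCongruence (E : ∀ {σ : Ty}, Farc V σ → Farc V σ → Prop) : Prop where
  isCongruence : (farcStructure V E).IsCongruence
  of_conv : ∀ {σ : Ty} {t t' : Farc V σ}, Conv t t' → E t t'
  conv_of_N : ∀ {t t' : Farc V .N}, E t t' → Conv t t'

namespace IsFarcCongruence

open StructureData

theorem valid_of_red (hE : IsFarcCongruence E) {σ : Ty} {s t : CTTerm Γ σ}
    (h : ∀ a : (farcStructure V E).Assignment Γ, ∃ u v : Coterm V,
      ((farcStructure V E).eval a s).1 = u ∧ ((farcStructure V E).eval a t).1 = v ∧ Red u v) :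
    (farcStructure V E).Valid (.eq s t) := by
  intro a
  obtain ⟨_, _, rfl, rfl, h⟩ := h a
  exact hE.of_conv (.rel _ _ h)

theorem valid_ax (hE : IsFarcCongruence E) {φ : Formula Γ} (h : CTAxiom φ) :
    (farcStructure V E).Valid φ := by
  have hM := farcStructure_isTypeStructure (V := V) (E := E)
  cases h with
  | refl t => exact fun a => hE.isCongruence.refl _
  | leibniz s t φ =>
    rintro a ⟨h, hs⟩
    rw [sat_inst hM] at hs ⊢
    exact (hE.isCongruence.sat_cons hM a (x := ⟨_, hM.eval_mem a s⟩)
      (y := ⟨_, hM.eval_mem a t⟩) h φ).1 hs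
  | ident s t h =>
    intro a
    change E _ _
    rw [Subtype.ext (eval_eq_of_toCoterm_eq a h)]
    exact hE.isCongruence.refl _
  | id σ x => exact hE.valid_of_red fun a => ⟨_, _, rfl, rfl, .id σ (evalCoterm a x)⟩
  | ex ρs ρ σ σs τ t xs x y ys =>
    refine hE.valid_of_red fun a => ⟨_, _, ?_, ?_, .ex ρs ρ σ σs τ (evalCoterm a t) (evalCoterm a x) (evalCoterm a y)
      (xs.values a) (ys.values a) (xs.length_values a) (ys.length_values a)⟩
    · rw [eval_apps, Args.values_append]; rfl
    · rw [eval_apps, Args.values_append]; rfl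
  | wk σs σ τ t xs x =>
    refine hE.valid_of_red fun a => ⟨_, _, ?_, ?_, .wk σs σ τ (evalCoterm a t) (evalCoterm a x)
      (xs.values a) (xs.length_values a)⟩
    · rw [eval_apps, Args.snoc, Args.values_append]; rfl
    · rw [eval_apps]
  | cntr σs σ τ t xs x =>
    refine hE.valid_of_red fun a => ⟨_, _, ?_, ?_, .cntr σs σ τ (evalCoterm a t) (evalCoterm a x)
      (xs.values a) (xs.length_values a)⟩
    · rw [eval_apps, Args.snoc, Args.values_append]; rfl
    · rw [eval_apps, Args.values_append]; rfl
  | cut σs σ τ s t xs =>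
    refine hE.valid_of_red fun a => ⟨_, _, ?_, ?_, .cut σs σ τ (evalCoterm a s) (evalCoterm a t)
      (xs.values a) (xs.length_values a)⟩
    · rw [eval_apps]; rfl
    · rw [eval_apps, Args.snoc, Args.values_append, Args.values, Args.values, eval_apps]
  | L σs ρ σ τ s t xs y =>
    refine hE.valid_of_red fun a => ⟨_, _, ?_, ?_, .L σs ρ σ τ (evalCoterm a s) (evalCoterm a t) (evalCoterm a y)
      (xs.values a) (xs.length_values a)⟩
    · rw [eval_apps, Args.snoc, Args.values_append]; rfl
    · rw [eval_apps, Args.snoc, Args.values_append, ← eval_apps]; rfl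
  | R σs σ τ t xs x =>
    refine hE.valid_of_red fun a => ⟨_, _, ?_, ?_, .R σs σ τ (evalCoterm a t) (evalCoterm a x)
      (xs.values a) (xs.length_values a)⟩
    · rw [Coterm.apps_snoc]
      exact congrArg (Coterm.app · _) (eval_apps a _ xs)
    · rw [eval_apps, Args.snoc, Args.values_append]; rfl
  | condZero σs τ s t xs =>
    refine hE.valid_of_red fun a => ⟨_, _, ?_, ?_, .condZero σs τ (evalCoterm a s) (evalCoterm a t)
      (xs.values a) (xs.length_values a)⟩
    · rw [eval_apps, Args.snoc, Args.values_append]; rfl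
    · rw [eval_apps]
  | condSucc σs τ s t xs y =>
    refine hE.valid_of_red fun a => ⟨_, _, ?_, ?_, .condSucc σs τ (evalCoterm a s) (evalCoterm a t) (evalCoterm a y)
      (xs.values a) (xs.length_values a)⟩
    · rw [eval_apps, Args.snoc, Args.values_append]; rfl
    · rw [eval_apps, Args.snoc, Args.values_append]; rfl
  | succ_ne_zero x =>
    intro a h
    obtain ⟨_, n, hn⟩ := mem_HRset_iff.1 (hM.eval_mem a x)
    have := ((hE.conv_of_N h).val_iff (n + 1)).1 (val_succ_iff.2 hn)
    cases this.unique Val.zero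
  | succ_inj x y =>
    intro a h
    obtain ⟨_, n, hn⟩ := mem_HRset_iff.1 (hM.eval_mem a x)
    have := ((hE.conv_of_N h).val_iff (n + 1)).1 (val_succ_iff.2 hn)
    exact hE.of_conv (conv_of_val hn (val_succ_iff.1 this))

theorem valid_ind (hE : IsFarcCongruence E) (φ : Formula (Ty.N :: Γ))
    (h0 : (farcStructure V E).Valid (φ.inst CTTerm.zero))
    (h1 : (farcStructure V E).Valid (Formula.imp φ φ.instSucc)) (t : CTTerm Γ Ty.N) :
    (farcStructure V E).Valid (φ.inst t) := by
  have hM := farcStructure_isTypeStructure (V := V) (E := E)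
  intro a
  have num_mem : ∀ n, numeral V n ∈ HRset V .N := fun n => ⟨n, .refl _⟩
  have key : ∀ n, (farcStructure V E).Sat (a.cons ⟨numeral V n, num_mem n⟩) φ := by
    intro n
    induction n with
    | zero => exact (sat_inst hM a φ CTTerm.zero).1 (h0 a)
    | succ n ih =>
      have := h1 _ ih
      rw [Formula.instSucc, sat_subst hM, subst_cons, subst_weaken] at this
      exact this
  obtain ⟨n, hn⟩ := hM.eval_mem a t
  rw [sat_inst hM]
  exact (hE.isCongruence.sat_cons hM a (x := ⟨_, hM.eval_mem a t⟩) (y := ⟨_, num_mem n⟩)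
    (hE.of_conv hn) φ).2 (key n)

theorem isModel (hE : IsFarcCongruence E) {ER : Prop}
    (hext : ER → ∀ {Γ : List Ty} {σ τ : Ty} (s t : CTTerm Γ (Ty.arr σ τ)),
      (farcStructure V E).Valid (extPremise s t) → (farcStructure V E).Valid (Formula.eq s t)) :
    (farcStructure V E).IsModel ER where
  isTypeStructure := farcStructure_isTypeStructure
  ind φ _ h0 h1 t := hE.valid_ind φ h0 h1 t
  ext := hext
  theorems φ h a := sat_of_proves farcStructure_isTypeStructure hE.valid_ax hE.valid_ind hext h a
    (by simp)

end IsFarcCongruence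

end

theorem isFarcCongruence_conv : IsFarcCongruence (V := V) Conv where
  isCongruence :=
    { refl := .refl
      symm := .symm
      trans := .trans
      app := fun _ _ _ => .app }
  of_conv h := h
  conv_of_N h := h

theorem ExtEq.of_conv {σ : Ty} {t t' : Farc V σ} (h : Conv t t') : ExtEq V σ t t' := by
  induction σ with
  | N => exact h
  | arr σ τ _ ih => exact fun s _ => ih (h.app (.refl s))

theorem ExtEq.symm {σ : Ty} {t t' : Farc V σ} (h : ExtEq V σ t t') : ExtEq V σ t' t := by
  induction σ with
  | N => exact Conv.symm h
  | arr σ τ _ ih => exact fun s hs => ih (h s hs)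

theorem ExtEq.trans {σ : Ty} {t t' t'' : Farc V σ} (h : ExtEq V σ t t') (h' : ExtEq V σ t' t'') :
    ExtEq V σ t t'' := by
  induction σ with
  | N => exact Conv.trans h h'
  | arr σ τ _ ih => exact fun s hs => ih (h s hs) (h' s hs)

theorem isFarcCongruence_extEq : IsFarcCongruence (V := V) (fun {σ} => ExtEq V σ) where
  isCongruence :=
    { refl := fun x => .of_conv (.refl x)
      symm := .symm
      trans := .trans
      app := fun ht hs hs' h h' => (extEq_app ht hs h').trans (h _ hs') }
  of_conv := .of_conv
  conv_of_N h := h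

theorem HE_valid_ext {Γ : List Ty} {σ τ : Ty} (s t : CTTerm Γ (Ty.arr σ τ))
    (h : (HE V).Valid (extPremise s t)) : (HE V).Valid (Formula.eq s t) := by
  intro a x hx
  have hM : (HE V).IsTypeStructure := farcStructure_isTypeStructure
  have := h (a.cons ⟨x, hx⟩)
  simp only [extPremise, StructureData.Sat, StructureData.eval, StructureData.eval_subst hM,
    StructureData.subst_weaken] at this
  exact this

end CircularT

theorem mainTheorem5 (V : CircularT.Ty → Type) :
    (CircularT.HR V).IsModel False ∧ (CircularT.HE V).IsModel True :=
  ⟨CircularT.isFarcCongruence_conv.isModel (fun h => h.elim),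
    CircularT.isFarcCongruence_extEq.isModel fun _ _ _ _ s t => CircularT.HE_valid_ext s t⟩
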